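/- **Setting.** Let $f:\mathbb R^n\to\mathbb R$ be twice continuously differentiable, $x^0\in\mathbb R^n$, and let $\mathscr L=\{x: f(x)\le f(x^0)\}$ be compact. Let $f_{\rm low}\in\mathbb R$, $U_g,U_H>0$ satisfy $f\ge f_{\rm low}$, $\|\nabla f\|\le U_g$, $\|\nabla^2 f\|\le U_H$ on $\mathscr L$, and put $\Delta_f=f(x^0)-f_{\rm low}$, $r_d=\max\{1.1,\,1.1U_g,\,U_H\}$. Assume that for some $\nu\in(0,1]$ and $H_f\ge1$, $\|\nabla^2 f(y)-\nabla^2 f(x)\|\le H_f\|y-x\|^\nu$ for all $x,y$ within distance $r_d$ of $\mathscr L$. For $x\ne y$ let $$\mathcal H_0(y,x)=\frac{2\,|f(y)-f(x)-\nabla f(x)^{\rm T}(y-x)-\frac12(y-x)^{\rm T}\nabla^2f(x)(y-x)|}{\|y-x\|^{2+\nu}},\qquad \mathcal H_1(y,x)=\frac{\|\nabla f(y)-\nabla f(x)-\nabla^2 f(x)(y-x)\|}{\|y-x\|^{1+\nu}}.$$ **Subroutine.** $\mathtt{CappedCG}(H,g,\zeta,\sigma)$ (capped conjugate gradients of Royer,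 O'Neill and Wright): let $\bar H=H+2\sigma I$ and say that $d$ has *low curvature* if $d^{\rm T}\bar Hd<\sigma\|d\|^2$. Let $y^0=0$, $r^0=g$, $p^0=-g$ and, for $j\ge0$, $\alpha_j=\|r^j\|^2/((p^j)^{\rm T}\bar Hp^j)$, $y^{j+1}=y^j+\alpha_jp^j$, $r^{j+1}=r^j+\alpha_j\bar Hp^j$, $p^{j+1}=-r^{j+1}+\frac{\|r^{j+1}\|^2}{\|r^j\|^2}p^j$. Let $U_j$ be the largest of $0$, of $\|Hp^0\|/\|p^0\|$ and of $\|Hv\|/\|v\|$ over the nonzero $v\in\{p^i,y^i,r^i:1\le i\le j\}$, and $\kappa=(U_j+2\sigma)/\sigma$, $\hat\zeta=\zeta/(3\kappa)$, $\tau=\sqrt\kappa/(\sqrt\kappa+1)$, $T=4\kappa^4/(1-\sqrt\tau)^2$. If $p^0$ has low curvature return $(p^0,\mathrm{NC})$. Otherwise for $j=1,2,\dots$: if $y^j$ has low curvature return $(y^j,\mathrm{NC})$; else if $\|r^j\|\le\hat\zeta\|r^0\|$ return $(y^j,\mathrm{SOL})$; else if $p^j$ has low curvature return $(p^j,\mathrm{NC})$;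 else if $\|r^j\|>\sqrt T\,\tau^{j/2}\|r^0\|$ return $(y^{j+1}-y^i,\mathrm{NC})$ for some $i\in\{0,\dots,j-1\}$ for which $y^{j+1}-y^i$ has low curvature. **Algorithm.** Inputs: $x^0$, $\nu$, $\gamma_0\ge1$, $\eta,\theta\in(0,1)$. While $g_k=\nabla f(x^k)\ne0$, put $H_k=\nabla^2f(x^k)$, $\varepsilon_k=(\gamma_k\|g_k\|^\nu)^{1/(1+\nu)}$, $\zeta_k=\min\{\frac12,\|g_k\|^{\nu/(1+\nu)}\}$ and $(d,\text{type})=\mathtt{CappedCG}(H_k,g_k,\zeta_k,\varepsilon_k)$. If type is NC, let $d^k=-\operatorname{sgn}(d^{\rm T}g_k)\frac{|d^{\rm T}H_kd|}{\|d\|^3}d$ (with $\operatorname{sgn}0=1$), let $j_k$ be the least $j\ge0$ with $f(x^k+\theta^jd^k)<f(x^k)-\frac\eta2\theta^{2j}\|d^k\|^3$; if $j_k\ge1$ let $\sigma_k=\mathcal H_0(x^k+\theta^{j_k-1}d^k,x^k)$, and if $j_k=0$ let $\sigma_k=0$ (no update). If type is SOL, let $d^k=d$, let $j_k$ be the least $j\ge0$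 with $f(x^k+\theta^jd^k)<f(x^k)-\eta\varepsilon_k\theta^j\|d^k\|^2$; let $\sigma_k=\mathcal H_1(x^k+d^k,x^k)$ if $j_k=0$ and $\sigma_k=\max\{\mathcal H_0(x^k+d^k,x^k),\mathcal H_0(x^k+\theta^{j_k-1}d^k,x^k)\}$ otherwise. Then $x^{k+1}=x^k+\theta^{j_k}d^k$ and $\gamma_{k+1}=\max\{\gamma_k,\sigma_k\}$. **Theorem.** The algorithm is well defined: every finite execution can be continued, until a point with zero gradient is reached (if it ever is). For $\epsilon>0$ let $\mathbb K_\epsilon=\{k:\|\nabla f(x^t)\|>\epsilon\ \ \forall t\le k\}$ be the set of iterations before an $\epsilon$-stationary point is found. Then, as $\epsilon\to0$, $$|\mathbb K_\epsilon|\le O\Big(\Delta_f\,H_f^{\frac1{1+\nu}}\,\epsilon^{-\frac{2+\nu}{1+\nu}}\Big),$$ without any logarithmic factor, in both of the following senses. (a) There is a constant $C>0$ that depends only on $\nu,\eta,\theta,\gamma_0$ such that, for every $n$, every $f,x^0,H_f,U_g,U_H,f_{\rm low}$ as above and every sequence generated by the algorithm, $|\mathbb K_\epsilon|\le C\Delta_fH_f^{1/(1+\nu)}\epsilon^{-(2+\nu)/(1+\nu)}$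 for all sufficiently small $\epsilon>0$ (the threshold may depend on the problem and on the generated sequence). (b) For every $n$ there is a constant $C>0$ that depends only on $n,\nu,\eta,\theta,\gamma_0$ such that the same bound holds for all $0<\epsilon\le\epsilon_0$ with a threshold $\epsilon_0>0$ that depends only on $n,\nu,\eta,\theta,\gamma_0,H_f,U_g,U_H,\Delta_f$, uniformly over all such $f:\mathbb R^n\to\mathbb R$, $x^0$ and generated sequences. -/

import Mathlib

/-! ### The capped conjugate gradient method -/

/-- `d` has curvature below `σ` for the damped operator `H + 2σ I`. -/
def LowCurvature {n : ℕ}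
    (H : EuclideanSpace ℝ (Fin n) →L[ℝ] EuclideanSpace ℝ (Fin n)) (σ : ℝ)
    (d : EuclideanSpace ℝ (Fin n)) : Prop :=
  inner ℝ d (H d + (2 * σ) • d) < σ * ‖d‖ ^ 2

/-- The vectors `y`, `r`, `p` carried by conjugate gradients. -/
structure CGState (n : ℕ) where
  /-- current approximate solution -/
  y : EuclideanSpace ℝ (Fin n)
  /-- current residual -/
  r : EuclideanSpace ℝ (Fin n)
  /-- current search direction -/
  p : EuclideanSpace ℝ (Fin n)

/-- One standard CG step for `(H + 2σ I) d = -g`. -/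
noncomputable def cgNext {n : ℕ}
    (H : EuclideanSpace ℝ (Fin n) →L[ℝ] EuclideanSpace ℝ (Fin n)) (σ : ℝ)
    (s : CGState n) : CGState n :=
  let Hp := H s.p + (2 * σ) • s.p
  let α := inner ℝ s.r s.r / inner ℝ s.p Hp
  let r' := s.r + α • Hp
  let β := ‖r'‖ ^ 2 / ‖s.r‖ ^ 2
  { y := s.y + α • s.p, r := r', p := -r' + β • s.p }

/-- The CG iterates, started at `y⁰ = 0`, `r⁰ = g`, `p⁰ = -g`. -/
noncomputable def cgState {n : ℕ}
    (H : EuclideanSpace ℝ (Fin n) →L[ℝ] EuclideanSpace ℝ (Fin n))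
    (g : EuclideanSpace ℝ (Fin n)) (σ : ℝ) : ℕ → CGState n
  | 0 => { y := 0, r := g, p := -g }
  | j + 1 => cgNext H σ (cgState H g σ j)

/-- The running estimate `U` of `‖H‖`: zero at the start, then updated at every iteration. -/
noncomputable def cappedU {n : ℕ}
    (H : EuclideanSpace ℝ (Fin n) →L[ℝ] EuclideanSpace ℝ (Fin n))
    (g : EuclideanSpace ℝ (Fin n)) (σ : ℝ) : ℕ → ℝ
  | 0 => 0
  | j + 1 =>
    let s₀ := cgState H g σ 0
    let s := cgState H g σ (j + 1)
    max (cappedU H g σ j)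
      (max (‖H s₀.p‖ / ‖s₀.p‖)
        (max (‖H s.p‖ / ‖s.p‖) (max (‖H s.y‖ / ‖s.y‖) (‖H s.r‖ / ‖s.r‖))))

/-- `κ = (U + 2σ) / σ`. -/
noncomputable def cappedKappa (U σ : ℝ) : ℝ := (U + 2 * σ) / σ

/-- `ζ̂ = ζ / (3κ)`. -/
noncomputable def cappedZeta (U ζ σ : ℝ) : ℝ := ζ / (3 * cappedKappa U σ)

/-- `τ = √κ / (√κ + 1)`. -/
noncomputable def cappedTau (U σ : ℝ) : ℝ :=
  Real.sqrt (cappedKappa U σ) / (Real.sqrt (cappedKappa U σ) + 1)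

/-- `T = 4κ⁴ / (1 - √τ)²`. -/
noncomputable def cappedT (U σ : ℝ) : ℝ :=
  4 * cappedKappa U σ ^ 4 / (1 - Real.sqrt (cappedTau U σ)) ^ 2

/-- The residual test `‖rʲ‖ ≤ ζ̂ ‖r⁰‖`. -/
def ResidualSmall {n : ℕ}
    (H : EuclideanSpace ℝ (Fin n) →L[ℝ] EuclideanSpace ℝ (Fin n))
    (g : EuclideanSpace ℝ (Fin n)) (ζ σ : ℝ) (j : ℕ) : Prop :=
  ‖(cgState H g σ j).r‖ ≤ cappedZeta (cappedU H g σ j) ζ σ * ‖(cgState H g σ 0).r‖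

/-- The slow-decay test `‖rʲ‖ > √T τ^(j/2) ‖r⁰‖`. -/
def ResidualSlow {n : ℕ}
    (H : EuclideanSpace ℝ (Fin n) →L[ℝ] EuclideanSpace ℝ (Fin n))
    (g : EuclideanSpace ℝ (Fin n)) (σ : ℝ) (j : ℕ) : Prop :=
  Real.sqrt (cappedT (cappedU H g σ j) σ) * cappedTau (cappedU H g σ j) σ ^ ((j : ℝ) / 2)
    * ‖(cgState H g σ 0).r‖ < ‖(cgState H g σ j).r‖

/-- The tests of the main loop are carried out at `j ≥ 1`: nothing was returned earlier. -/
def CappedReaches {n : ℕ}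
    (H : EuclideanSpace ℝ (Fin n) →L[ℝ] EuclideanSpace ℝ (Fin n))
    (g : EuclideanSpace ℝ (Fin n)) (ζ σ : ℝ) (j : ℕ) : Prop :=
  1 ≤ j ∧ ¬ LowCurvature H σ (cgState H g σ 0).p ∧
    ∀ i, 1 ≤ i → i < j →
      ¬ LowCurvature H σ (cgState H g σ i).y ∧ ¬ ResidualSmall H g ζ σ i ∧
      ¬ LowCurvature H σ (cgState H g σ i).p ∧ ¬ ResidualSlow H g σ i

/-- Type of the output: approximate solution or negative curvature direction. -/
inductive CGType : Type
  | sol : CGType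
  | nc : CGType

/-- `CappedCG H g ζ σ d t`: the capped CG method terminates on the input `(H, g, ζ, σ)` with the
output `(d, t)`. The only freedom is the choice of `i` in the last branch. -/
inductive CappedCG {n : ℕ}
    (H : EuclideanSpace ℝ (Fin n) →L[ℝ] EuclideanSpace ℝ (Fin n))
    (g : EuclideanSpace ℝ (Fin n)) (ζ σ : ℝ) :
    EuclideanSpace ℝ (Fin n) → CGType → Prop
  | start : LowCurvature H σ (cgState H g σ 0).p →
      CappedCG H g ζ σ (cgState H g σ 0).p CGType.nc
  | iterate (j : ℕ) : CappedReaches H g ζ σ j →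
      LowCurvature H σ (cgState H g σ j).y →
      CappedCG H g ζ σ (cgState H g σ j).y CGType.nc
  | solved (j : ℕ) : CappedReaches H g ζ σ j →
      ¬ LowCurvature H σ (cgState H g σ j).y → ResidualSmall H g ζ σ j →
      CappedCG H g ζ σ (cgState H g σ j).y CGType.sol
  | direction (j : ℕ) : CappedReaches H g ζ σ j →
      ¬ LowCurvature H σ (cgState H g σ j).y → ¬ ResidualSmall H g ζ σ j →
      LowCurvature H σ (cgState H g σ j).p →
      CappedCG H g ζ σ (cgState H g σ j).p CGType.nc
  | slow (j i : ℕ) : CappedReaches H g ζ σ j →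
      ¬ LowCurvature H σ (cgState H g σ j).y → ¬ ResidualSmall H g ζ σ j →
      ¬ LowCurvature H σ (cgState H g σ j).p → ResidualSlow H g σ j →
      i < j →
      LowCurvature H σ ((cgState H g σ (j + 1)).y - (cgState H g σ i).y) →
      CappedCG H g ζ σ ((cgState H g σ (j + 1)).y - (cgState H g σ i).y) CGType.nc

/-! ### The adaptive regularized Newton-CG method -/

/-- The Hessian of `f` at `x`, as the derivative of the gradient. -/
noncomputable def hess {n : ℕ} (f : EuclideanSpace ℝ (Fin n) → ℝ)
    (x : EuclideanSpace ℝ (Fin n)) :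
    EuclideanSpace ℝ (Fin n) →L[ℝ] EuclideanSpace ℝ (Fin n) :=
  fderiv ℝ (gradient f) x

/-- Second-order Taylor residual of `f`. -/
noncomputable def residualZero {n : ℕ} (f : EuclideanSpace ℝ (Fin n) → ℝ)
    (y x : EuclideanSpace ℝ (Fin n)) : ℝ :=
  |f y - f x - inner ℝ (gradient f x) (y - x) - 1 / 2 * inner ℝ (y - x) (hess f x (y - x))|

/-- First-order Taylor residual of the gradient of `f`. -/
noncomputable def residualOne {n : ℕ} (f : EuclideanSpace ℝ (Fin n) → ℝ)
    (y x : EuclideanSpace ℝ (Fin n)) : ℝ :=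
  ‖gradient f y - gradient f x - hess f x (y - x)‖

/-- Lower estimator of the Hölder constant from function values. -/
noncomputable def estimatorZero {n : ℕ} (f : EuclideanSpace ℝ (Fin n) → ℝ) (ν : ℝ)
    (y x : EuclideanSpace ℝ (Fin n)) : ℝ :=
  2 * residualZero f y x / ‖y - x‖ ^ (2 + ν)

/-- Lower estimator of the Hölder constant from gradients. -/
noncomputable def estimatorOne {n : ℕ} (f : EuclideanSpace ℝ (Fin n) → ℝ) (ν : ℝ)
    (y x : EuclideanSpace ℝ (Fin n)) : ℝ :=
  residualOne f y x / ‖y - x‖ ^ (1 + ν)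

/-- The damping parameter `(γ ‖g‖^ν)^(1/(1+ν))`. -/
noncomputable def damping {n : ℕ} (ν γ : ℝ) (g : EuclideanSpace ℝ (Fin n)) : ℝ :=
  (γ * ‖g‖ ^ ν) ^ (1 / (1 + ν))

/-- The relative accuracy `min {1/2, ‖g‖^(ν/(1+ν))}`. -/
noncomputable def accuracy {n : ℕ} (ν : ℝ) (g : EuclideanSpace ℝ (Fin n)) : ℝ :=
  min (1 / 2) (‖g‖ ^ (ν / (1 + ν)))

/-- The rescaled and oriented negative curvature direction
`-sgn(dᵀg) (|dᵀHd| / ‖d‖³) d`, where `sgn z = 1` for `z ≥ 0` and `-1` for `z < 0`. -/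
noncomputable def ncDirection {n : ℕ}
    (H : EuclideanSpace ℝ (Fin n) →L[ℝ] EuclideanSpace ℝ (Fin n))
    (g d : EuclideanSpace ℝ (Fin n)) : EuclideanSpace ℝ (Fin n) :=
  (-(if 0 ≤ inner ℝ d g then (1 : ℝ) else -1) * (|inner ℝ d (H d)| / ‖d‖ ^ 3)) • d

/-- Exponents `j` accepted by the line search along a negative curvature direction `d`. -/
def acceptNC {n : ℕ} (f : EuclideanSpace ℝ (Fin n) → ℝ) (η θ : ℝ)
    (x d : EuclideanSpace ℝ (Fin n)) : Set ℕ :=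
  {j | f (x + θ ^ j • d) < f x - η / 2 * θ ^ (2 * j) * ‖d‖ ^ 3}

/-- Exponents `j` accepted by the line search along a damped Newton direction `d`. -/
def acceptSOL {n : ℕ} (f : EuclideanSpace ℝ (Fin n) → ℝ) (η θ ε : ℝ)
    (x d : EuclideanSpace ℝ (Fin n)) : Set ℕ :=
  {j | f (x + θ ^ j • d) < f x - η * ε * θ ^ j * ‖d‖ ^ 2}

/-- `NewtonCGStep f ν η θ x γ x' γ'`: one iteration of the method may take the current point and
estimate `(x, γ)` to `(x', γ')`. -/
inductive NewtonCGStep {n : ℕ} (f : EuclideanSpace ℝ (Fin n) → ℝ) (ν η θ : ℝ)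
    (x : EuclideanSpace ℝ (Fin n)) (γ : ℝ) : EuclideanSpace ℝ (Fin n) → ℝ → Prop
  | nc (d e : EuclideanSpace ℝ (Fin n)) (j : ℕ) :
      CappedCG (hess f x) (gradient f x) (accuracy ν (gradient f x))
        (damping ν γ (gradient f x)) d CGType.nc →
      e = ncDirection (hess f x) (gradient f x) d →
      IsLeast (acceptNC f η θ x e) j →
      NewtonCGStep f ν η θ x γ (x + θ ^ j • e)
        (if 1 ≤ j then max γ (estimatorZero f ν (x + θ ^ (j - 1) • e) x) else γ)
  | sol (d : EuclideanSpace ℝ (Fin n)) (j : ℕ) :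
      CappedCG (hess f x) (gradient f x) (accuracy ν (gradient f x))
        (damping ν γ (gradient f x)) d CGType.sol →
      IsLeast (acceptSOL f η θ (damping ν γ (gradient f x)) x d) j →
      NewtonCGStep f ν η θ x γ (x + θ ^ j • d)
        (max γ
          (if j = 0 then estimatorOne f ν (x + d) x
            else max (estimatorZero f ν (x + d) x)
              (estimatorZero f ν (x + θ ^ (j - 1) • d) x)))

/-- The first `N` iterations of an execution from `x₀`, `γ₀`; the sequences are continued as
constants once the method has stopped at a point with zero gradient. -/
def IsPartialRun {n : ℕ} (f : EuclideanSpace ℝ (Fin n) → ℝ) (ν η θ γ₀ : ℝ)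
    (x₀ : EuclideanSpace ℝ (Fin n)) (N : ℕ) (x : ℕ → EuclideanSpace ℝ (Fin n)) (γ : ℕ → ℝ) :
    Prop :=
  x 0 = x₀ ∧ γ 0 = γ₀ ∧ ∀ k < N,
    (gradient f (x k) ≠ 0 → NewtonCGStep f ν η θ (x k) (γ k) (x (k + 1)) (γ (k + 1))) ∧
    (gradient f (x k) = 0 → x (k + 1) = x k ∧ γ (k + 1) = γ k)

/-- A complete execution. -/
def IsRun {n : ℕ} (f : EuclideanSpace ℝ (Fin n) → ℝ) (ν η θ γ₀ : ℝ)
    (x₀ : EuclideanSpace ℝ (Fin n)) (x : ℕ → EuclideanSpace ℝ (Fin n)) (γ : ℕ → ℝ) : Prop :=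
  ∀ N, IsPartialRun f ν η θ γ₀ x₀ N x γ

/-- The iterations before an `ε`-stationary point is found. -/
def nonstationary {n : ℕ} (f : EuclideanSpace ℝ (Fin n) → ℝ)
    (x : ℕ → EuclideanSpace ℝ (Fin n)) (ε : ℝ) : Set ℕ :=
  {k | ∀ t ≤ k, ε < ‖gradient f (x t)‖}

/-! ### The problem class -/

/-- The level set of `f` at `u`. -/
def levelSet {n : ℕ} (f : EuclideanSpace ℝ (Fin n) → ℝ) (u : EuclideanSpace ℝ (Fin n)) :
    Set (EuclideanSpace ℝ (Fin n)) :=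
  {x | f x ≤ f u}

/-- The `r`-neighbourhood of the level set of `f` at `u`. -/
def levelNhd {n : ℕ} (f : EuclideanSpace ℝ (Fin n) → ℝ) (u : EuclideanSpace ℝ (Fin n)) (r : ℝ) :
    Set (EuclideanSpace ℝ (Fin n)) :=
  {x | ∃ x' ∈ levelSet f u, ‖x - x'‖ ≤ r}

/-- The standing assumptions: `f` is `C²`, its level set at `x₀` is compact, `fLow`, `Ug`, `UH`
are bounds for `f`, its gradient and its Hessian there, and the Hessian is `(Hf, ν)`-Hölder
on the neighbourhood of radius `max {1.1, 1.1 Ug, UH}`. -/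
structure StandingAssumptions {n : ℕ} (f : EuclideanSpace ℝ (Fin n) → ℝ)
    (x₀ : EuclideanSpace ℝ (Fin n)) (ν Hf Ug UH fLow : ℝ) : Prop where
  contDiff : ContDiff ℝ 2 f
  compact_levelSet : IsCompact (levelSet f x₀)
  Ug_pos : 0 < Ug
  UH_pos : 0 < UH
  one_le_Hf : 1 ≤ Hf
  lower_bound : ∀ x ∈ levelSet f x₀, fLow ≤ f x
  gradient_bound : ∀ x ∈ levelSet f x₀, ‖gradient f x‖ ≤ Ug
  hess_bound : ∀ x ∈ levelSet f x₀, ‖hess f x‖ ≤ UH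
  holder : ∀ x ∈ levelNhd f x₀ (max (1.1 : ℝ) (max (1.1 * Ug) UH)),
    ∀ y ∈ levelNhd f x₀ (max (1.1 : ℝ) (max (1.1 * Ug) UH)),
      ‖hess f y - hess f x‖ ≤ Hf * ‖y - x‖ ^ ν

/-! Fix `ε`, an iteration with estimate `Γ`, and `δ` with `Γ δ^(1+ν) = ε`. The natural unit of
decrease is `Γ δ^(2+ν)`. As long as the gradients exceed `ε` and the estimate stays below `2Γ`,
every step gains a fixed fraction of this unit, except for full damped Newton steps of length at
most `ρδ` (`StandingAssumptions.step_dichotomy`). The true Hölder constant plays no role there: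
rejected trial steps are controlled by the same estimators that enter the update of `γ`.

The core is that `2(n+1) + L` consecutive short steps are impossible, where `L` is of order `log
(Hf/Γ)` (`RunFacts.window_decrease`). A short step satisfies `g_{k+1} ≈ -2 e_k d_k`, with `e_k` the
damping, and shrinks the gradient. The last `L` steps of the window force the gradients in its first
part above `2^L ε`, so the dampings there exceed `Hf δ^ν` and dominate the variation of the Hessian.
Then `g_k ≈ g_{k+1} - H_k d_k`, the symmetry of `H_k` and `H_k d_l ≈ H_l d_l` make `g_k` nearly
orthogonal to each later `d_l`, while `g_{k+1}` is nearly antiparallel to `d_k`. The inner products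
of `g_{2i+1}` with `d_{2j}` thus form a nearly triangular matrix, and `n+1` steps would be linearly
independent in dimension `n` (`no_long_chain`).

For the count (`RunFacts.count_le`), a logarithm is at most a multiple of a power, so a window has
length at most `W (Hf/Γ)^(1/(1+ν))`, and it gains `A ε^((2+ν)/(1+ν)) / Γ^(1/(1+ν))`. The quotient
does not contain `Γ`; this is why no logarithm survives. Windows in which `γ` doubles, and the last
incomplete one, contribute an amount independent of `ε`, absorbed when `ε` is small. The resulting
factor `Q = W/A` depends on `n`. It disappears in the sequence-dependent bound because the values `f
(x k)` converge: counting starts at an index after which `Q` times the remaining decrease is below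
the initial gap, and the iterations before that index are again an amount independent of `ε`.

Well-definedness rests on two facts. Nonzero CG residuals are orthogonal, so CG ends within the
dimension, and slow residual decay produces the required difference of low curvature
(`cg_residual_decay`). Line searches end because rejected steps cannot be arbitrarily short. -/

theorem LowCurvature.ne_zero {n : ℕ}
    {H : EuclideanSpace ℝ (Fin n) →L[ℝ] EuclideanSpace ℝ (Fin n)} {σ : ℝ}
    {d : EuclideanSpace ℝ (Fin n)} (h : LowCurvature H σ d) : d ≠ 0 := by
  rintro rfl
  simp [LowCurvature] at h

/-- The damped operator `H + 2σ I`. -/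
noncomputable def damped {n : ℕ}
    (H : EuclideanSpace ℝ (Fin n) →L[ℝ] EuclideanSpace ℝ (Fin n)) (σ : ℝ) :
    EuclideanSpace ℝ (Fin n) →L[ℝ] EuclideanSpace ℝ (Fin n) :=
  H + (2 * σ) • ContinuousLinearMap.id ℝ _

theorem damped_apply {n : ℕ}
    (H : EuclideanSpace ℝ (Fin n) →L[ℝ] EuclideanSpace ℝ (Fin n)) (σ : ℝ)
    (v : EuclideanSpace ℝ (Fin n)) : damped H σ v = H v + (2 * σ) • v := by
  simp [damped]

theorem not_lowCurvature {n : ℕ}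
    {H : EuclideanSpace ℝ (Fin n) →L[ℝ] EuclideanSpace ℝ (Fin n)} {σ : ℝ}
    {d : EuclideanSpace ℝ (Fin n)} (h : ¬ LowCurvature H σ d) :
    σ * ‖d‖ ^ 2 ≤ inner ℝ d (damped H σ d) := by
  rw [damped_apply]
  exact not_lt.1 h

theorem damped_symm {n : ℕ}
    {H : EuclideanSpace ℝ (Fin n) →L[ℝ] EuclideanSpace ℝ (Fin n)} {σ : ℝ}
    (hH : ∀ v w, inner ℝ (H v) w = inner ℝ v (H w)) (v w : EuclideanSpace ℝ (Fin n)) :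
    inner ℝ (damped H σ v) w = inner ℝ v (damped H σ w) := by
  simp [damped_apply, inner_add_left, inner_add_right, hH, inner_smul_left, inner_smul_right]

/-! ### Conjugate gradients: recurrences, orthogonality, and the norm estimate. -/

section CG

variable {n : ℕ} {H : EuclideanSpace ℝ (Fin n) →L[ℝ] EuclideanSpace ℝ (Fin n)}
  {g : EuclideanSpace ℝ (Fin n)} {σ ζ : ℝ}

/-- The step length of conjugate gradients. -/
noncomputable def cgAlpha (H : EuclideanSpace ℝ (Fin n) →L[ℝ] EuclideanSpace ℝ (Fin n))
    (g : EuclideanSpace ℝ (Fin n)) (σ : ℝ) (j : ℕ) : ℝ :=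
  ‖(cgState H g σ j).r‖ ^ 2 /
    inner ℝ (cgState H g σ j).p (damped H σ (cgState H g σ j).p)

/-- The conjugation coefficient of conjugate gradients. -/
noncomputable def cgBeta (H : EuclideanSpace ℝ (Fin n) →L[ℝ] EuclideanSpace ℝ (Fin n))
    (g : EuclideanSpace ℝ (Fin n)) (σ : ℝ) (j : ℕ) : ℝ :=
  ‖(cgState H g σ (j + 1)).r‖ ^ 2 / ‖(cgState H g σ j).r‖ ^ 2

theorem cg_y_succ (j : ℕ) : (cgState H g σ (j + 1)).y =
    (cgState H g σ j).y + cgAlpha H g σ j • (cgState H g σ j).p := by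
  simp [cgState, cgNext, cgAlpha, damped_apply]

theorem cg_r_succ (j : ℕ) : (cgState H g σ (j + 1)).r =
    (cgState H g σ j).r + cgAlpha H g σ j • damped H σ (cgState H g σ j).p := by
  simp [cgState, cgNext, cgAlpha, damped_apply]

theorem cg_p_succ (j : ℕ) : (cgState H g σ (j + 1)).p =
    -(cgState H g σ (j + 1)).r + cgBeta H g σ j • (cgState H g σ j).p := by
  simp [cgState, cgNext, cgBeta]

theorem cg_residual (j : ℕ) :
    (cgState H g σ j).r = g + damped H σ (cgState H g σ j).y := by
  induction j with
  | zero => simp [cgState]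
  | succ j ih => rw [cg_r_succ, cg_y_succ, map_add, map_smul, ih, add_assoc]

/-- Conjugate gradients has not broken down before iteration `m`. -/
def CGRegular (H : EuclideanSpace ℝ (Fin n) →L[ℝ] EuclideanSpace ℝ (Fin n))
    (g : EuclideanSpace ℝ (Fin n)) (σ : ℝ) (m : ℕ) : Prop :=
  ∀ i < m, (cgState H g σ i).r ≠ 0 ∧ ¬ LowCurvature H σ (cgState H g σ i).p

theorem CGRegular.mono {m k : ℕ} (h : CGRegular H g σ m) (hk : k ≤ m) : CGRegular H g σ k :=
  fun i hi => h i (hi.trans_le hk)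

theorem curvature_pos (hσ : 0 < σ) {v : EuclideanSpace ℝ (Fin n)} (hv : v ≠ 0)
    (h : ¬ LowCurvature H σ v) : 0 < inner ℝ v (damped H σ v) :=
  lt_of_lt_of_le (by have := norm_pos_iff.2 hv; positivity) (not_lowCurvature h)

/-- The orthogonality relations of conjugate gradients. -/
theorem cg_orthogonality (hσ : 0 < σ) (hH : ∀ v w, inner ℝ (H v) w = inner ℝ v (H w))
    (m : ℕ) (h : CGRegular H g σ m) :
    (∀ i < m, inner ℝ (cgState H g σ m).r (cgState H g σ i).p = 0) ∧
    (∀ i < m, inner ℝ (cgState H g σ m).r (cgState H g σ i).r = 0) ∧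
    (∀ i < m, inner ℝ (cgState H g σ m).p (damped H σ (cgState H g σ i).p) = 0) ∧
    inner ℝ (cgState H g σ m).p (cgState H g σ m).r = -‖(cgState H g σ m).r‖ ^ 2 := by
  induction m using Nat.strong_induction_on with
  | _ m ih =>
  rcases m with _ | m
  · simp [cgState]
  have hp : ∀ i ≤ m, (cgState H g σ i).p ≠ 0 := by
    intro i hi h0
    have h1 := (ih i (by omega) (h.mono (by omega))).2.2.2
    rw [h0, inner_zero_left] at h1
    exact (h i (by omega)).1 (by simpa using h1)
  have hq : ∀ i ≤ m, 0 < inner ℝ (cgState H g σ i).p (damped H σ (cgState H g σ i).p) :=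
    fun i hi => curvature_pos hσ (hp i hi) (h i (by omega)).2
  have hα : ∀ i ≤ m, cgAlpha H g σ i ≠ 0 := by
    intro i hi
    have := norm_pos_iff.2 (h i (by omega)).1
    have := hq i hi
    unfold cgAlpha
    positivity
  obtain ⟨h1, h2, h3, h4⟩ := ih m (by omega) (h.mono (by omega))
  have hrp : ∀ i < m + 1, inner ℝ (cgState H g σ (m + 1)).r (cgState H g σ i).p = 0 := by
    intro i hi
    -- For `i < m` both terms vanish by induction; for `i = m` the step length `cgAlpha` is exactly
    -- what cancels them.
    rw [cg_r_succ, inner_add_left, inner_smul_left, damped_symm hH]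
    rcases Nat.lt_succ_iff_lt_or_eq.1 hi with hi | rfl
    · rw [h1 i hi, h3 i hi]
      simp
    · rw [real_inner_comm, h4]
      have := (hq i le_rfl).ne'
      simp only [cgAlpha, conj_trivial]
      field_simp
      ring
  have hrr : ∀ i < m + 1, inner ℝ (cgState H g σ (m + 1)).r (cgState H g σ i).r = 0 := by
    intro i hi
    rcases i with _ | i
    · have := hrp 0 hi
      simpa [cgState] using this
    · have e : (cgState H g σ (i + 1)).r = -(cgState H g σ (i + 1)).p +
          cgBeta H g σ i • (cgState H g σ i).p := by
        rw [cg_p_succ]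
        abel
      rw [e, inner_add_right, inner_neg_right, inner_smul_right, hrp _ hi, hrp i (by omega)]
      simp
  refine ⟨hrp, hrr, ?_, ?_⟩
  · intro i hi
    -- The residual recurrence expresses the damped image of `p i` as a difference of residuals,
    -- which reduces conjugacy to orthogonality of residuals.
    have e : inner ℝ (cgState H g σ (m + 1)).r (damped H σ (cgState H g σ i).p) =
        (inner ℝ (cgState H g σ (m + 1)).r (cgState H g σ (i + 1)).r -
          inner ℝ (cgState H g σ (m + 1)).r (cgState H g σ i).r) / cgAlpha H g σ i := by
      rw [cg_r_succ i, inner_add_right, inner_smul_right]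
      field_simp [hα i (by omega)]
      ring
    rw [cg_p_succ, inner_add_left, inner_neg_left, inner_smul_left, e, hrr i hi]
    rcases Nat.lt_succ_iff_lt_or_eq.1 hi with hi | rfl
    · rw [hrr (i + 1) (by omega), h3 i hi]
      simp
    · have := (hq i le_rfl).ne'
      have := norm_ne_zero_iff.2 (h i (by omega)).1
      rw [real_inner_self_eq_norm_sq]
      simp only [cgAlpha, cgBeta, conj_trivial]
      field_simp
      ring
  · rw [cg_p_succ, inner_add_left, inner_neg_left, inner_smul_left, real_inner_comm,
      real_inner_self_eq_norm_sq, real_inner_comm, hrp m (by omega)]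
    simp

theorem cg_p_ne_zero (hσ : 0 < σ) (hH : ∀ v w, inner ℝ (H v) w = inner ℝ v (H w))
    {m : ℕ} (h : CGRegular H g σ m) (hr : (cgState H g σ m).r ≠ 0) :
    (cgState H g σ m).p ≠ 0 := by
  intro h0
  have h1 := (cg_orthogonality hσ hH m h).2.2.2
  rw [h0, inner_zero_left] at h1
  exact hr (by simpa using h1)

theorem cg_r_inner_y (hσ : 0 < σ) (hH : ∀ v w, inner ℝ (H v) w = inner ℝ v (H w))
    {m : ℕ} (h : CGRegular H g σ m) {i : ℕ} (hi : i ≤ m) :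
    inner ℝ (cgState H g σ m).r (cgState H g σ i).y = 0 := by
  induction i with
  | zero => simp [cgState]
  | succ i ih =>
    rw [cg_y_succ, inner_add_right, inner_smul_right, ih (by omega),
      (cg_orthogonality hσ hH m h).1 i (by omega)]
    simp

theorem cg_p_conj_y (hσ : 0 < σ) (hH : ∀ v w, inner ℝ (H v) w = inner ℝ v (H w))
    {m : ℕ} (h : CGRegular H g σ m) {i : ℕ} (hi : i ≤ m) :
    inner ℝ (cgState H g σ m).p (damped H σ (cgState H g σ i).y) = 0 := by
  induction i with
  | zero => simp [cgState]
  | succ i ih =>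
    rw [cg_y_succ, map_add, map_smul, inner_add_right, inner_smul_right, ih (by omega),
      (cg_orthogonality hσ hH m h).2.2.1 i (by omega)]
    simp

/-- Some residual among the first `n + 1` vanishes, unless conjugate gradients breaks down. -/
theorem not_cgRegular (hσ : 0 < σ) (hH : ∀ v w, inner ℝ (H v) w = inner ℝ v (H w)) :
    ¬ CGRegular H g σ (n + 1) := by
  intro h
  have hli : LinearIndependent ℝ (fun i : Fin (n + 1) => (cgState H g σ i).r) := by
    refine linearIndependent_of_ne_zero_of_inner_eq_zero (fun i => (h i i.2).1) ?_
    intro i j hij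
    rcases lt_or_gt_of_ne (Fin.val_ne_of_ne hij) with hlt | hlt
    · change inner ℝ (cgState H g σ i).r (cgState H g σ j).r = 0
      rw [real_inner_comm]
      exact (cg_orthogonality hσ hH j (h.mono (by omega))).2.1 i hlt
    · exact (cg_orthogonality hσ hH i (h.mono (by omega))).2.1 j hlt
  have := hli.fintype_card_le_finrank
  simp at this

/-! ### The running norm estimate -/

theorem cappedU_nonneg (j : ℕ) : 0 ≤ cappedU H g σ j := by
  induction j with
  | zero => simp [cappedU]
  | succ j ih => exact le_max_of_le_left ih

theorem cappedU_mono : Monotone (cappedU H g σ) :=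
  monotone_nat_of_le_succ fun j => by
    rw [cappedU]
    exact le_max_left _ _

theorem norm_le_of_div_le {v : EuclideanSpace ℝ (Fin n)} {U : ℝ} (h : ‖H v‖ / ‖v‖ ≤ U) :
    ‖H v‖ ≤ U * ‖v‖ := by
  rcases eq_or_ne v 0 with rfl | hv
  · simp
  · exact (div_le_iff₀ (norm_pos_iff.2 hv)).1 h

theorem norm_apply_y_le {j : ℕ} (hj : 1 ≤ j) :
    ‖H (cgState H g σ j).y‖ ≤ cappedU H g σ j * ‖(cgState H g σ j).y‖ := by
  obtain ⟨j, rfl⟩ := Nat.exists_eq_add_of_le' hj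
  apply norm_le_of_div_le
  rw [cappedU]
  simp only [le_max_iff]
  simp only [le_refl, true_or, or_true]

/-- The running estimate never tests `r⁰` itself; the case `i = 0` is covered by `p⁰ = -r⁰`. -/
theorem norm_apply_r_le {i j : ℕ} (hj : 1 ≤ j) (hij : i ≤ j) :
    ‖H (cgState H g σ i).r‖ ≤ cappedU H g σ j * ‖(cgState H g σ i).r‖ := by
  rcases i with _ | i
  · have h1 : ‖H (cgState H g σ 0).r‖ ≤ cappedU H g σ 1 * ‖(cgState H g σ 0).r‖ := by
      apply norm_le_of_div_le
      rw [cappedU]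
      simp [cgState]
    exact h1.trans (mul_le_mul_of_nonneg_right (cappedU_mono hj) (norm_nonneg _))
  · have h1 : ‖H (cgState H g σ (i + 1)).r‖ ≤
        cappedU H g σ (i + 1) * ‖(cgState H g σ (i + 1)).r‖ := by
      apply norm_le_of_div_le
      rw [cappedU]
      simp only [le_max_iff]
      simp only [le_refl, or_true]
    exact h1.trans (mul_le_mul_of_nonneg_right (cappedU_mono hij) (norm_nonneg _))

theorem two_le_cappedKappa {U : ℝ} (hU : 0 ≤ U) (hσ : 0 < σ) : 2 ≤ cappedKappa U σ := by
  rw [cappedKappa, le_div_iff₀ hσ]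
  linarith

theorem cappedKappa_mul {U : ℝ} (hσ : 0 < σ) : cappedKappa U σ * σ = U + 2 * σ := by
  rw [cappedKappa]
  field_simp

end CG

/-! ### Linear convergence and termination of the capped method. -/

section CGTheory

variable {n : ℕ} {H : EuclideanSpace ℝ (Fin n) →L[ℝ] EuclideanSpace ℝ (Fin n)}
  {g : EuclideanSpace ℝ (Fin n)} {σ ζ : ℝ}

/-- Geometric decay of a sequence whose tails are bounded by multiples of its terms. -/
theorem le_of_tail_sum_le {q : ℝ} (hq : 1 ≤ q) (j : ℕ) (E : ℕ → ℝ)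
    (h : ∀ m ≤ j, ∑ i ∈ Finset.Ico m (j + 1), E i ≤ q * E m) :
    E j ≤ (1 - 1 / q) ^ j * (q * E 0) := by
  have hq0 : 0 < q := by linarith
  have hc : 0 ≤ 1 - 1 / q := by
    rw [sub_nonneg, div_le_one hq0]
    exact hq
  have key : ∀ m ≤ j, ∑ i ∈ Finset.Ico m (j + 1), E i ≤ (1 - 1 / q) ^ m * (q * E 0) := by
    intro m
    induction m with
    | zero => intro _; simpa using h 0 (Nat.zero_le _)
    | succ m ih =>
      intro hm
      have h1 := ih (by omega)
      have h2 := h m (by omega)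
      rw [Finset.sum_eq_sum_Ico_succ_bot (by omega)] at h1 h2
      set S := ∑ i ∈ Finset.Ico (m + 1) (j + 1), E i
      have h3 : S ≤ (1 - 1 / q) * (E m + S) := by
        have : (E m + S) / q ≤ E m := by
          rw [div_le_iff₀ hq0]
          linarith
        have e : (1 - 1 / q) * (E m + S) = (E m + S) - (E m + S) / q := by ring
        linarith
      calc S ≤ (1 - 1 / q) * (E m + S) := h3
        _ ≤ (1 - 1 / q) * ((1 - 1 / q) ^ m * (q * E 0)) := mul_le_mul_of_nonneg_left h1 hc
        _ = _ := by ring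
  have := key j le_rfl
  simpa using this

theorem norm_sum_sq_le_of_orthogonal (r : ℕ → EuclideanSpace ℝ (Fin n)) (s : Finset ℕ)
    (h : ∀ i ∈ s, ∀ k ∈ s, i ≠ k → inner ℝ (r i) (r k) = 0) :
    ‖∑ i ∈ s, r i‖ ^ 2 = ∑ i ∈ s, ‖r i‖ ^ 2 := by
  rw [← real_inner_self_eq_norm_sq, sum_inner]
  refine Finset.sum_congr rfl fun i hi => ?_
  rw [inner_sum, Finset.sum_eq_single_of_mem i hi fun k hk hki => h i hi k hk hki.symm,
    real_inner_self_eq_norm_sq]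

/-- Since `r = -p + β p'` with `p` and `p'` conjugate, the curvature of `r` is that of `p` plus a
nonnegative term. So the norm estimate on residuals controls the curvature of directions in terms of
`‖r‖`, although only finitely many vectors were tested. -/
theorem cg_curvature_p_le (hσ : 0 < σ) (hH : ∀ v w, inner ℝ (H v) w = inner ℝ v (H w))
    {i j : ℕ} (hj : 1 ≤ j) (hij : i ≤ j) (h : CGRegular H g σ i) :
    inner ℝ (cgState H g σ i).p (damped H σ (cgState H g σ i).p) ≤
      (cappedU H g σ j + 2 * σ) * ‖(cgState H g σ i).r‖ ^ 2 := by
  have h1 : inner ℝ (cgState H g σ i).r (damped H σ (cgState H g σ i).r) ≤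
      (cappedU H g σ j + 2 * σ) * ‖(cgState H g σ i).r‖ ^ 2 := by
    rw [damped_apply, inner_add_right, inner_smul_right, real_inner_self_eq_norm_sq]
    have h2 := real_inner_le_norm (cgState H g σ i).r (H (cgState H g σ i).r)
    have h3 := mul_le_mul_of_nonneg_left (norm_apply_r_le (H := H) (g := g) (σ := σ) hj hij)
      (norm_nonneg (cgState H g σ i).r)
    nlinarith
  refine le_trans ?_ h1
  rcases i with _ | i
  · simp [cgState]
  · have e : (cgState H g σ (i + 1)).r = -(cgState H g σ (i + 1)).p +
        cgBeta H g σ i • (cgState H g σ i).p := by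
      rw [cg_p_succ]
      abel
    have h2 := (cg_orthogonality hσ hH _ h).2.2.1 i (by omega)
    have h3 : inner ℝ (cgState H g σ i).p (damped H σ (cgState H g σ (i + 1)).p) = 0 := by
      rw [← damped_symm hH, real_inner_comm]
      exact h2
    have h4 : 0 ≤ inner ℝ (cgState H g σ i).p (damped H σ (cgState H g σ i).p) :=
      le_trans (by positivity) (not_lowCurvature (h i (by omega)).2)
    rw [e]
    simp only [map_add, map_neg, map_smul, inner_add_left, inner_add_right, inner_neg_left,
      inner_neg_right, inner_smul_left, inner_smul_right, h2, h3, conj_trivial]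
    nlinarith [mul_nonneg (sq_nonneg (cgBeta H g σ i)) h4]

/-- Linear convergence of conjugate gradients when the curvature along all differences
`y^(j+1) - y^i` is at least `σ`. -/
theorem cg_residual_decay (hσ : 0 < σ) (hH : ∀ v w, inner ℝ (H v) w = inner ℝ v (H w))
    {j : ℕ} (hj : 1 ≤ j) (hreg : CGRegular H g σ (j + 1))
    (hcurv : ∀ i < j, ¬ LowCurvature H σ ((cgState H g σ (j + 1)).y - (cgState H g σ i).y)) :
    ‖(cgState H g σ j).r‖ ^ 2 ≤
      (1 - 1 / √(cappedKappa (cappedU H g σ j) σ)) ^ j *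
        (cappedKappa (cappedU H g σ j) σ * √(cappedKappa (cappedU H g σ j) σ) * ‖g‖ ^ 2) := by
  set K := cappedKappa (cappedU H g σ j) σ with hK
  have hK2 : 2 ≤ K := two_le_cappedKappa (cappedU_nonneg j) hσ
  have hKσ : K * σ = cappedU H g σ j + 2 * σ := cappedKappa_mul hσ
  set y := fun i => (cgState H g σ i).y with hy
  set r := fun i => (cgState H g σ i).r with hr
  set p := fun i => (cgState H g σ i).p with hp
  set E := fun i => inner ℝ (y i - y (j + 1)) (damped H σ (y i - y (j + 1))) with hE
  have hry : ∀ m ≤ j + 1, ∀ i ≤ m, inner ℝ (r m) (y i) = 0 := fun m hm i hi =>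
    cg_r_inner_y hσ hH (hreg.mono hm) hi
  have hBe : ∀ i, damped H σ (y i - y (j + 1)) = r i - r (j + 1) := by
    intro i
    rw [map_sub]
    simp only [hr, hy, cg_residual]
    abel
  -- The left factor may be any earlier iterate, since residuals are orthogonal to all iterates up
  -- to their own index. A tail sum of energies is then a single inner product.
  have hEinner : ∀ i ≤ j + 1, ∀ m ≤ i, E i = inner ℝ (y m - y (j + 1)) (r i) := by
    intro i hi m hm
    simp only [hE, hBe]
    simp only [inner_sub_left, inner_sub_right]
    rw [real_inner_comm, real_inner_comm (r (j + 1)) (y i), real_inner_comm (r i) (y m),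
      hry i hi i le_rfl, hry (j + 1) le_rfl i hi, hry i hi m hm,
      real_inner_comm (r (j + 1)) (y (j + 1)), hry (j + 1) le_rfl (j + 1) le_rfl]
    ring
  have hElast : E (j + 1) = 0 := by simp [hE]
  have hpne : ∀ i ≤ j, p i ≠ 0 := fun i hi =>
    cg_p_ne_zero hσ hH (hreg.mono (by omega)) (hreg i (by omega)).1
  have hpg : ∀ i ≤ j, inner ℝ g (p i) = -‖r i‖ ^ 2 := by
    intro i hi
    have h1 := (cg_orthogonality hσ hH i (hreg.mono (by omega))).2.2.2
    have h2 := cg_p_conj_y hσ hH (hreg.mono (show i ≤ j + 1 by omega)) le_rfl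
    rw [cg_residual i, inner_add_right, h2, ← cg_residual i, real_inner_comm] at h1
    simpa using h1
  have hstep : ∀ i ≤ j, ‖r i‖ ^ 2 ≤ K * σ * (E i - E (i + 1)) := by
    intro i hi
    have hqpos := curvature_pos hσ (hpne i hi) (hreg i (by omega)).2
    have hq := cg_curvature_p_le hσ hH hj hi (hreg.mono (by omega))
    rw [← hKσ] at hq
    have hrpos : 0 < ‖r i‖ := norm_pos_iff.2 (hreg i (by omega)).1
    have e1 : E i - E (i + 1) = cgAlpha H g σ i * ‖r i‖ ^ 2 := by
      rw [hEinner i (by omega) 0 (by omega), hEinner (i + 1) (by omega) 0 (by omega)]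
      have hy0 : y 0 = 0 := rfl
      have hrs : r (i + 1) = r i + cgAlpha H g σ i • damped H σ (p i) := cg_r_succ i
      have hBy : damped H σ (y (j + 1)) = r (j + 1) - g := by
        simp only [hr, hy, cg_residual (j + 1)]
        abel
      have hrp : inner ℝ (r (j + 1)) (p i) = 0 :=
        (cg_orthogonality hσ hH (j + 1) hreg).1 i (by omega)
      rw [hy0, hrs, inner_add_right, inner_smul_right, zero_sub, inner_neg_left (y (j + 1))
        (damped H σ (p i)), ← damped_symm hH, hBy, inner_sub_left, hrp, hpg i hi]
      ring
    have e2 : cgAlpha H g σ i * inner ℝ (p i) (damped H σ (p i)) = ‖r i‖ ^ 2 := by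
      simp only [cgAlpha]
      exact div_mul_cancel₀ _ hqpos.ne'
    have hα : 0 < cgAlpha H g σ i := div_pos (by positivity) hqpos
    rw [e1]
    calc ‖r i‖ ^ 2 = cgAlpha H g σ i * inner ℝ (p i) (damped H σ (p i)) := e2.symm
      _ ≤ cgAlpha H g σ i * (K * σ * ‖r i‖ ^ 2) := mul_le_mul_of_nonneg_left hq hα.le
      _ = _ := by ring
  -- For `m < j` this is the curvature hypothesis on differences; for `m = j` the difference is a
  -- multiple of `p j`, whose curvature was tested separately.
  have hstrong : ∀ m ≤ j, σ * ‖y m - y (j + 1)‖ ^ 2 ≤ E m := by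
    intro m hm
    rcases hm.lt_or_eq with hm | rfl
    · have := not_lowCurvature (hcurv m hm)
      rw [← neg_sub, norm_neg, map_neg, inner_neg_neg] at this
      exact this
    · have e : y m - y (m + 1) = -(cgAlpha H g σ m • p m) := by
        simp only [hy, cg_y_succ m]
        simp [hp]
      have := not_lowCurvature (hreg m (by omega)).2
      simp only [hE, e, norm_neg, map_neg, map_smul, inner_neg_neg, norm_smul, inner_smul_left,
        inner_smul_right, Real.norm_eq_abs, conj_trivial, mul_pow, sq_abs]
      calc _ = cgAlpha H g σ m * cgAlpha H g σ m * (σ * ‖p m‖ ^ 2) := by ring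
        _ ≤ cgAlpha H g σ m * cgAlpha H g σ m * inner ℝ (p m) (damped H σ (p m)) :=
          mul_le_mul_of_nonneg_left this (mul_self_nonneg _)
        _ = _ := by ring
  have hEnn : ∀ i ≤ j, 0 ≤ E i := fun i hi => le_trans (by positivity) (hstrong i hi)
  -- Cauchy–Schwarz with Pythagoras for the orthogonal residuals: their squared norms telescope to
  -- at most `K σ E m`, and the strong curvature gives the other factor. The square root of the
  -- product is where the rate `√K` comes from.
  have htail : ∀ m ≤ j, ∑ i ∈ Finset.Ico m (j + 1), E i ≤ √K * E m := by
    intro m hm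
    set R := ∑ i ∈ Finset.Ico m (j + 1), r i
    have h1 : ∑ i ∈ Finset.Ico m (j + 1), E i = inner ℝ (y m - y (j + 1)) R := by
      rw [inner_sum]
      refine Finset.sum_congr rfl fun i hi => ?_
      rw [Finset.mem_Ico] at hi
      exact hEinner i (by omega) m hi.1
    have h2 : ‖R‖ ^ 2 ≤ K * σ * E m := by
      rw [norm_sum_sq_le_of_orthogonal]
      · calc ∑ i ∈ Finset.Ico m (j + 1), ‖r i‖ ^ 2
            ≤ ∑ i ∈ Finset.Ico m (j + 1), K * σ * (E i - E (i + 1)) :=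
              Finset.sum_le_sum fun i hi => hstep i (by rw [Finset.mem_Ico] at hi; omega)
          _ = K * σ * (E m - E (j + 1)) := by
              rw [← Finset.mul_sum]
              congr 1
              have := Finset.sum_Ico_sub E (show m ≤ j + 1 by omega)
              rw [← neg_sub, ← this, ← Finset.sum_neg_distrib]
              simp
          _ = K * σ * E m := by rw [hElast, sub_zero]
      · intro i hi k hk hik
        rw [Finset.mem_Ico] at hi hk
        rcases lt_or_gt_of_ne hik with hlt | hlt
        · rw [real_inner_comm]
          exact (cg_orthogonality hσ hH k (hreg.mono (by omega))).2.1 i hlt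
        · exact (cg_orthogonality hσ hH i (hreg.mono (by omega))).2.1 k hlt
    rw [h1]
    refine (real_inner_le_norm _ _).trans ?_
    refine (pow_le_pow_iff_left₀ (by positivity)
      (mul_nonneg (Real.sqrt_nonneg _) (hEnn m hm)) two_ne_zero).1 ?_
    · have h3 := hstrong m hm
      have h4 := hEnn m hm
      rw [mul_pow, mul_pow, Real.sq_sqrt (by linarith)]
      have : σ * (‖y m - y (j + 1)‖ ^ 2 * ‖R‖ ^ 2) ≤ σ * (K * E m ^ 2) := by
        calc _ = (σ * ‖y m - y (j + 1)‖ ^ 2) * ‖R‖ ^ 2 := by ring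
          _ ≤ E m * (K * σ * E m) := mul_le_mul h3 h2 (by positivity) h4
          _ = _ := by ring
      exact le_of_mul_le_mul_left this hσ
  have hsq1 : 1 ≤ √K := by
    rw [Real.one_le_sqrt]
    linarith
  have hfin := le_of_tail_sum_le hsq1 j E htail
  have hE0 : σ * E 0 ≤ ‖g‖ ^ 2 := by
    have h1 : E 0 ≤ ‖y 0 - y (j + 1)‖ * ‖g‖ := by
      rw [hEinner 0 (by omega) 0 le_rfl]
      exact real_inner_le_norm _ _
    have h2 := hstrong 0 (by omega)
    have h3 := hEnn 0 (by omega)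
    nlinarith [sq_nonneg (σ * ‖y 0 - y (j + 1)‖ - ‖g‖), norm_nonneg g,
      norm_nonneg (y 0 - y (j + 1))]
  have hlast := hstep j le_rfl
  rw [hElast, sub_zero] at hlast
  have hc : 0 ≤ (1 - 1 / √K) ^ j := by
    apply pow_nonneg
    rw [sub_nonneg, div_le_one (by linarith)]
    exact hsq1
  calc ‖r j‖ ^ 2 ≤ K * σ * E j := hlast
    _ ≤ K * σ * ((1 - 1 / √K) ^ j * (√K * E 0)) :=
      mul_le_mul_of_nonneg_left hfin (by positivity)
    _ = (1 - 1 / √K) ^ j * (K * √K * (σ * E 0)) := by ring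
    _ ≤ _ := by gcongr

/-- Otherwise `cg_residual_decay` applies, and its bound is below the slow-decay threshold: `1 -
1/√κ ≤ τ`, and the factor `κ√κ` is at most `T`. -/
theorem exists_lowCurvature_of_residualSlow (hσ : 0 < σ)
    (hH : ∀ v w, inner ℝ (H v) w = inner ℝ v (H w))
    {j : ℕ} (hj : 1 ≤ j) (hreg : CGRegular H g σ (j + 1)) (hslow : ResidualSlow H g σ j) :
    ∃ i < j, LowCurvature H σ ((cgState H g σ (j + 1)).y - (cgState H g σ i).y) := by
  by_contra! hcon
  have h1 := cg_residual_decay hσ hH hj hreg hcon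
  unfold ResidualSlow cappedT cappedTau at hslow
  set K := cappedKappa (cappedU H g σ j) σ with hK
  have hK2 : 2 ≤ K := two_le_cappedKappa (cappedU_nonneg j) hσ
  have hs : 1 ≤ √K := by
    rw [Real.one_le_sqrt]
    linarith
  have hsq : √K ^ 2 = K := Real.sq_sqrt (by linarith)
  set q := √K
  set t := q / (q + 1) with ht
  have ht0 : 0 < t := by positivity
  have ht1 : t < 1 := by
    rw [ht, div_lt_one (by linarith)]
    linarith
  have hst : √t < 1 := by
    rw [Real.sqrt_lt' one_pos]
    simpa using ht1
  have hg0 : (cgState H g σ 0).r = g := rfl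
  rw [hg0] at hslow
  have hT : K * q ≤ 4 * K ^ 4 / (1 - √t) ^ 2 := by
    rw [le_div_iff₀ (by have : 0 < 1 - √t := by linarith
                        positivity)]
    have h2 : (1 - √t) ^ 2 ≤ 1 := by
      have := Real.sqrt_nonneg t
      nlinarith
    have h3 : K * q ≤ 4 * K ^ 4 := by
      have : q ≤ K := by nlinarith
      calc K * q ≤ K * K := by gcongr
        _ ≤ K * K * (4 * K ^ 2) := le_mul_of_one_le_right (by positivity) (by nlinarith)
        _ = _ := by ring
    calc K * q * (1 - √t) ^ 2 ≤ K * q * 1 := by gcongr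
      _ ≤ _ := by linarith
  have hrate : 1 - 1 / q ≤ t := by
    rw [ht, sub_le_iff_le_add, div_add_div _ _ (by linarith) (by linarith), le_div_iff₀ (by positivity)]
    nlinarith
  have hrate0 : 0 ≤ 1 - 1 / q := by
    rw [sub_nonneg, div_le_one (by linarith)]
    exact hs
  have h2 := pow_lt_pow_left₀ hslow (by positivity) (two_ne_zero)
  rw [mul_pow, mul_pow, Real.sq_sqrt (by positivity)] at h2
  have e : (t ^ ((j : ℝ) / 2)) ^ 2 = t ^ j := by
    rw [← Real.rpow_natCast, ← Real.rpow_mul ht0.le, ← Real.rpow_natCast]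
    congr 1
    push_cast
    ring
  rw [e] at h2
  have h3 : (1 - 1 / q) ^ j * (K * q * ‖g‖ ^ 2) ≤ t ^ j * (4 * K ^ 4 / (1 - √t) ^ 2 * ‖g‖ ^ 2) := by
    gcongr
  linarith

theorem residualSmall_of_eq_zero (hσ : 0 < σ) (hζ : 0 ≤ ζ) {j : ℕ}
    (h : (cgState H g σ j).r = 0) : ResidualSmall H g ζ σ j := by
  have := two_le_cappedKappa (cappedU_nonneg (H := H) (g := g) (σ := σ) j) hσ
  rw [ResidualSmall, h, norm_zero, cappedZeta]
  positivity

/-- A vanishing residual passes the residual test, so CG cannot break down before a return. -/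
theorem CappedReaches.regular (hσ : 0 < σ) (hζ : 0 ≤ ζ) (hg : g ≠ 0) {j : ℕ}
    (h : CappedReaches H g ζ σ j) : CGRegular H g σ j := by
  intro i hi
  rcases i with _ | i
  · exact ⟨hg, h.2.1⟩
  · obtain ⟨-, h2, h3, -⟩ := h.2.2 (i + 1) (by omega) hi
    exact ⟨fun h0 => h2 (residualSmall_of_eq_zero hσ hζ h0), h3⟩

/-- The capped conjugate gradient method terminates. -/
theorem exists_cappedCG (hσ : 0 < σ) (hζ : 0 ≤ ζ) (hg : g ≠ 0)
    (hH : ∀ v w, inner ℝ (H v) w = inner ℝ v (H w)) :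
    ∃ d t, CappedCG H g ζ σ d t := by
  by_contra! hcon
  have h0 : ¬ LowCurvature H σ (cgState H g σ 0).p := fun h => hcon _ _ (.start h)
  have hall : ∀ j, CappedReaches H g ζ σ (j + 1) := by
    intro j
    induction j with
    | zero => exact ⟨le_rfl, h0, fun i h1 h2 => by omega⟩
    | succ j ih =>
      refine ⟨by omega, h0, fun i h1 h2 => ?_⟩
      rcases Nat.lt_succ_iff_lt_or_eq.1 h2 with h2 | rfl
      · exact ih.2.2 i h1 h2
      have hy : ¬ LowCurvature H σ (cgState H g σ (j + 1)).y :=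
        fun h => hcon _ _ (.iterate _ ih h)
      have hs : ¬ ResidualSmall H g ζ σ (j + 1) := fun h => hcon _ _ (.solved _ ih hy h)
      have hp : ¬ LowCurvature H σ (cgState H g σ (j + 1)).p :=
        fun h => hcon _ _ (.direction _ ih hy hs h)
      refine ⟨hy, hs, hp, fun h => ?_⟩
      have hreg : CGRegular H g σ (j + 1 + 1) := by
        intro i hi
        rcases Nat.lt_succ_iff_lt_or_eq.1 hi with hi | rfl
        · exact ih.regular hσ hζ hg i hi
        · exact ⟨fun h0 => hs (residualSmall_of_eq_zero hσ hζ h0), hp⟩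
      obtain ⟨i, hi, hl⟩ := exists_lowCurvature_of_residualSlow hσ hH (by omega) hreg h
      exact hcon _ _ (.slow _ i ih hy hs hp h hi hl)
  exact not_cgRegular hσ hH ((hall n).regular hσ hζ hg)

theorem CappedCG.lowCurvature {d : EuclideanSpace ℝ (Fin n)}
    (h : CappedCG H g ζ σ d CGType.nc) : LowCurvature H σ d := by
  cases h with
  | start h => exact h
  | iterate j _ h => exact h
  | direction j _ _ _ h => exact h
  | slow j i _ _ _ _ _ _ h => exact h

/-- Properties of an approximate solution returned by the capped conjugate gradient method. -/
theorem CappedCG.sol_properties (hσ : 0 < σ) (hζ : 0 ≤ ζ) (hζ1 : ζ ≤ 1 / 2) (hg : g ≠ 0)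
    (hH : ∀ v w, inner ℝ (H v) w = inner ℝ v (H w)) {d : EuclideanSpace ℝ (Fin n)}
    (h : CappedCG H g ζ σ d CGType.sol) :
    σ * ‖d‖ ^ 2 ≤ inner ℝ d (damped H σ d) ∧ inner ℝ d (g + damped H σ d) = 0 ∧
      ‖g + damped H σ d‖ ≤ 1 / 4 * σ * ‖d‖ ∧ σ * ‖d‖ ≤ ‖g‖ ∧ d ≠ 0 := by
  cases h with
  | solved j hj hy hs =>
  have hreg := hj.regular hσ hζ hg
  have hU := norm_apply_y_le (H := H) (g := g) (σ := σ) hj.1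
  have horth := cg_r_inner_y hσ hH hreg le_rfl
  have hcurv := not_lowCurvature hy
  have hr := cg_residual (H := H) (g := g) (σ := σ) j
  have hK2 := two_le_cappedKappa (cappedU_nonneg (H := H) (g := g) (σ := σ) j) hσ
  have hKσ := cappedKappa_mul (U := cappedU H g σ j) hσ
  have hgpos := norm_pos_iff.2 hg
  have hg0 : (cgState H g σ 0).r = g := rfl
  unfold ResidualSmall cappedZeta at hs
  rw [hg0] at hs
  set K := cappedKappa (cappedU H g σ j) σ
  rw [real_inner_comm] at horth
  set d := (cgState H g σ j).y
  set r := (cgState H g σ j).r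
  rw [← hr]
  have h1 : ‖g‖ ≤ K * σ * ‖d‖ + ‖r‖ := by
    have e : g = r - damped H σ d := by rw [hr]; abel
    calc ‖g‖ = ‖r - damped H σ d‖ := by rw [← e]
      _ ≤ ‖r‖ + ‖damped H σ d‖ := norm_sub_le _ _
      _ ≤ ‖r‖ + (‖H d‖ + ‖(2 * σ) • d‖) := by
        rw [damped_apply]
        gcongr
        exact norm_add_le _ _
      _ ≤ _ := by
        rw [norm_smul, Real.norm_of_nonneg (by positivity), hKσ]
        linarith
  have h2 : K * ‖r‖ ≤ 1 / 6 * ‖g‖ := by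
    calc K * ‖r‖ ≤ K * (ζ / (3 * K) * ‖g‖) := by gcongr
      _ = ζ / 3 * ‖g‖ := by field_simp
      _ ≤ _ := by nlinarith
  have h3 : ‖r‖ ≤ 1 / 12 * ‖g‖ := by nlinarith [norm_nonneg r]
  have h4 : ‖r‖ ≤ 1 / 4 * σ * ‖d‖ := by
    have : K * ‖r‖ ≤ K * (1 / 4 * σ * ‖d‖) := by linarith
    exact le_of_mul_le_mul_left this (by linarith)
  have hd : d ≠ 0 := by
    intro h0
    rw [h0, norm_zero] at h1
    linarith
  refine ⟨hcurv, horth, h4, ?_, hd⟩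
  have hdpos := norm_pos_iff.2 hd
  have h5 : inner ℝ d (damped H σ d) = -inner ℝ d g := by
    rw [hr, inner_add_right] at horth
    linarith
  have h6 : -inner ℝ d g ≤ ‖d‖ * ‖g‖ := by
    have := abs_le.1 (abs_real_inner_le_norm d g)
    linarith
  have : ‖d‖ * (σ * ‖d‖) ≤ ‖d‖ * ‖g‖ := by nlinarith
  exact le_of_mul_le_mul_left this hdpos

end CGTheory

/-! ### Taylor estimates and the Hölder estimators. -/

section Calculus

variable {n : ℕ} {f : EuclideanSpace ℝ (Fin n) → ℝ}

theorem differentiable_gradient (hf : ContDiff ℝ 2 f) : Differentiable ℝ (gradient f) := by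
  -- The inverse Riesz map is conjugate-linear by type; over the reals it is repackaged as a linear
  -- map so that it can be composed with the derivative.
  let L : StrongDual ℝ (EuclideanSpace ℝ (Fin n)) →ₗ[ℝ] EuclideanSpace ℝ (Fin n) :=
    { toFun := (InnerProductSpace.toDual ℝ (EuclideanSpace ℝ (Fin n))).symm
      map_add' := map_add _
      map_smul' := fun c v => by simp }
  have h1 : Differentiable ℝ (fderiv ℝ f) :=
    (hf.fderiv_right (m := 1) (by norm_num)).differentiable (by norm_num)
  exact L.toContinuousLinearMap.differentiable.comp h1

theorem hasFDerivAt_gradient (hf : ContDiff ℝ 2 f) (x : EuclideanSpace ℝ (Fin n)) :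
    HasFDerivAt (gradient f) (hess f x) x :=
  (differentiable_gradient hf x).hasFDerivAt

/-- This identification transfers the symmetry of the second derivative to `hess`. -/
theorem inner_hess (hf : ContDiff ℝ 2 f) (x v w : EuclideanSpace ℝ (Fin n)) :
    inner ℝ (hess f x v) w = fderiv ℝ (fderiv ℝ f) x v w := by
  have h1 : HasFDerivAt (fun y => inner ℝ (gradient f y) w)
      ((innerSL ℝ w).comp (hess f x)) x := by
    have := (innerSL ℝ w).hasFDerivAt.comp x (hasFDerivAt_gradient hf x)
    refine this.congr_of_eventuallyEq (Filter.Eventually.of_forall fun y => ?_)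
    exact real_inner_comm _ _
  have h2 : HasFDerivAt (fun y => fderiv ℝ f y w)
      ((ContinuousLinearMap.apply ℝ ℝ w).comp (fderiv ℝ (fderiv ℝ f) x)) x :=
    (ContinuousLinearMap.apply ℝ ℝ w).hasFDerivAt.comp x
      ((hf.fderiv_right (m := 1) (by norm_num)).differentiable (by norm_num) x).hasFDerivAt
  have h3 : (fun y => inner ℝ (gradient f y) w) = fun y => fderiv ℝ f y w := by
    funext y
    exact inner_gradient_left
  rw [h3] at h1
  have := congrArg (fun T => T v) (h1.unique h2)
  simpa [real_inner_comm] using this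

theorem hess_symm (hf : ContDiff ℝ 2 f) (x v w : EuclideanSpace ℝ (Fin n)) :
    inner ℝ (hess f x v) w = inner ℝ v (hess f x w) := by
  rw [real_inner_comm (hess f x w) v, inner_hess hf, inner_hess hf]
  exact (hf.contDiffAt.isSymmSndFDerivAt (by simp)) v w

theorem norm_gradient_taylor_le (hf : ContDiff ℝ 2 f) {x s : EuclideanSpace ℝ (Fin n)} {C : ℝ}
    (h : ∀ t ∈ Set.Icc (0 : ℝ) 1, ‖hess f (x + t • s) - hess f x‖ ≤ C) :
    ‖gradient f (x + s) - gradient f x - hess f x s‖ ≤ C * ‖s‖ := by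
  have h1 := (convex_segment x (x + s)).norm_image_sub_le_of_norm_hasFDerivWithin_le'
    (f := gradient f) (f' := hess f) (φ := hess f x) (C := C)
    (fun y _ => (hasFDerivAt_gradient hf y).hasFDerivWithinAt)
    (fun y hy => by
      rw [segment_eq_image'] at hy
      obtain ⟨t, ht, rfl⟩ := hy
      simpa using h t ht)
    (left_mem_segment ℝ x (x + s)) (right_mem_segment ℝ x (x + s))
  simpa using h1

theorem abs_taylor_le (hf : ContDiff ℝ 2 f) {x s : EuclideanSpace ℝ (Fin n)} {C : ℝ}
    (h : ∀ t ∈ Set.Icc (0 : ℝ) 1, ‖hess f (x + t • s) - hess f x‖ ≤ C) :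
    |f (x + s) - f x - inner ℝ (gradient f x) s - 1 / 2 * inner ℝ s (hess f x s)| ≤
      C * ‖s‖ ^ 2 := by
  have hC : 0 ≤ C := (norm_nonneg _).trans (h 0 (by simp))
  set φ : ℝ → ℝ := fun t => f (x + t • s) - t * inner ℝ (gradient f x) s -
    t ^ 2 * (1 / 2 * inner ℝ s (hess f x s)) with hφ
  have hd : ∀ t : ℝ, HasDerivAt φ
      (inner ℝ (gradient f (x + t • s) - gradient f x - hess f x (t • s)) s) t := by
    intro t
    have h1 : HasDerivAt (fun t : ℝ => x + t • s) s t := by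
      simpa using ((hasDerivAt_id t).smul_const s).const_add x
    have h2 : HasDerivAt (fun t : ℝ => f (x + t • s)) (inner ℝ (gradient f (x + t • s)) s) t := by
      rw [inner_gradient_left]
      exact ((hf.differentiable (by norm_num) _).hasFDerivAt).comp_hasDerivAt t h1
    have h3 := (h2.sub ((hasDerivAt_id t).mul_const (inner ℝ (gradient f x) s))).sub
      ((hasDerivAt_pow 2 t).mul_const (1 / 2 * inner ℝ s (hess f x s)))
    refine h3.congr_deriv ?_
    rw [inner_sub_left, inner_sub_left, map_smul, inner_smul_left, real_inner_comm s (hess f x s)]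
    simp
    ring
  have hb := norm_image_sub_le_of_norm_deriv_le_segment_01' (f := φ) (C := C * ‖s‖ ^ 2)
    (fun t _ => (hd t).hasDerivWithinAt) (fun t ht => by
      have h1 := norm_gradient_taylor_le hf (x := x) (s := t • s) (C := C) fun u hu => by
        rw [smul_smul]
        exact h _ ⟨mul_nonneg hu.1 ht.1, mul_le_one₀ hu.2 ht.1 ht.2.le⟩
      refine (norm_inner_le_norm _ _).trans ?_
      rw [norm_smul, Real.norm_of_nonneg ht.1] at h1
      calc _ ≤ C * (t * ‖s‖) * ‖s‖ := by gcongr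
        _ = t * (C * ‖s‖ ^ 2) := by ring
        _ ≤ _ := mul_le_of_le_one_left (by positivity) ht.2.le)
  rw [Real.norm_eq_abs] at hb
  convert hb using 2
  simp [hφ]
  ring

variable {x₀ : EuclideanSpace ℝ (Fin n)} {ν Hf Ug UH fLow : ℝ}

theorem mem_levelNhd {x : EuclideanSpace ℝ (Fin n)} (hx : x ∈ levelSet f x₀) {r : ℝ}
    {s : EuclideanSpace ℝ (Fin n)} (hs : ‖s‖ ≤ r) : x + s ∈ levelNhd f x₀ r :=
  ⟨x, hx, by simpa using hs⟩

theorem StandingAssumptions.hess_sub_le (S : StandingAssumptions f x₀ ν Hf Ug UH fLow)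
    (hν : 0 < ν) {x s : EuclideanSpace ℝ (Fin n)} (hx : x ∈ levelSet f x₀)
    (hs : ‖s‖ ≤ max (1.1 : ℝ) (max (1.1 * Ug) UH)) {t : ℝ} (ht : t ∈ Set.Icc (0 : ℝ) 1) :
    ‖hess f (x + t • s) - hess f x‖ ≤ Hf * ‖s‖ ^ ν := by
  have h1 : ‖t • s‖ ≤ ‖s‖ := by
    rw [norm_smul, Real.norm_of_nonneg ht.1]
    exact mul_le_of_le_one_left (norm_nonneg _) ht.2
  have h2 := S.holder x ⟨x, hx, by rw [sub_self, norm_zero]; exact (norm_nonneg s).trans hs⟩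
    (x + t • s) (mem_levelNhd hx (h1.trans hs))
  rw [add_sub_cancel_left] at h2
  have := S.one_le_Hf
  exact h2.trans (by gcongr)

theorem StandingAssumptions.estimatorZero_le (S : StandingAssumptions f x₀ ν Hf Ug UH fLow)
    (hν : 0 < ν) {x s : EuclideanSpace ℝ (Fin n)} (hx : x ∈ levelSet f x₀)
    (hs : ‖s‖ ≤ max (1.1 : ℝ) (max (1.1 * Ug) UH)) (hs0 : s ≠ 0) :
    estimatorZero f ν (x + s) x ≤ 2 * Hf := by
  have hp := norm_pos_iff.2 hs0
  have h1 := abs_taylor_le S.contDiff fun t ht => S.hess_sub_le hν hx hs ht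
  rw [estimatorZero, residualZero, add_sub_cancel_left, div_le_iff₀ (by positivity),
    Real.rpow_add hp, Real.rpow_two]
  linarith

theorem StandingAssumptions.estimatorOne_le (S : StandingAssumptions f x₀ ν Hf Ug UH fLow)
    (hν : 0 < ν) {x s : EuclideanSpace ℝ (Fin n)} (hx : x ∈ levelSet f x₀)
    (hs : ‖s‖ ≤ max (1.1 : ℝ) (max (1.1 * Ug) UH)) (hs0 : s ≠ 0) :
    estimatorOne f ν (x + s) x ≤ 2 * Hf := by
  have hp := norm_pos_iff.2 hs0
  have h1 := norm_gradient_taylor_le S.contDiff fun t ht => S.hess_sub_le hν hx hs ht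
  have h2 := S.one_le_Hf
  rw [estimatorOne, residualOne, add_sub_cancel_left, div_le_iff₀ (by positivity),
    Real.rpow_add hp, Real.rpow_one]
  have : 0 < ‖s‖ * ‖s‖ ^ ν := by positivity
  nlinarith

theorem taylor_upper {x s : EuclideanSpace ℝ (Fin n)} (hs : s ≠ 0) :
    f (x + s) ≤ f x + inner ℝ (gradient f x) s + 1 / 2 * inner ℝ s (hess f x s) +
      1 / 2 * estimatorZero f ν (x + s) x * ‖s‖ ^ (2 + ν) := by
  have hp := norm_pos_iff.2 hs
  have h1 : 1 / 2 * estimatorZero f ν (x + s) x * ‖s‖ ^ (2 + ν) = residualZero f (x + s) x := by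
    rw [estimatorZero, add_sub_cancel_left]
    field_simp
  rw [h1, residualZero, add_sub_cancel_left]
  linarith [le_abs_self (f (x + s) - f x - inner ℝ (gradient f x) s -
    1 / 2 * inner ℝ s (hess f x s))]

theorem residualOne_eq {x s : EuclideanSpace ℝ (Fin n)} (hs : s ≠ 0) :
    ‖gradient f (x + s) - gradient f x - hess f x s‖ =
      estimatorOne f ν (x + s) x * ‖s‖ ^ (1 + ν) := by
  have hp := norm_pos_iff.2 hs
  rw [estimatorOne, residualOne, add_sub_cancel_left]
  field_simp

/-! ### Search directions -/

theorem ncDirection_properties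
    {H : EuclideanSpace ℝ (Fin n) →L[ℝ] EuclideanSpace ℝ (Fin n)} {σ : ℝ} (hσ : 0 < σ)
    {g d : EuclideanSpace ℝ (Fin n)} (h : LowCurvature H σ d) :
    σ ≤ ‖ncDirection H g d‖ ∧
      inner ℝ (ncDirection H g d) (H (ncDirection H g d)) = -‖ncDirection H g d‖ ^ 3 ∧
      inner ℝ g (ncDirection H g d) ≤ 0 ∧ ‖ncDirection H g d‖ ≤ ‖H‖ := by
  have hd := norm_pos_iff.2 h.ne_zero
  unfold LowCurvature at h
  rw [inner_add_right, inner_smul_right, real_inner_self_eq_norm_sq] at h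
  set q := inner ℝ d (H d) with hq
  have hdσ : 0 < σ * ‖d‖ ^ 2 := by positivity
  have hq0 : q < 0 := by nlinarith
  have hqle : -q ≤ ‖H‖ * ‖d‖ ^ 2 := by
    have h1 := (abs_le.1 (abs_real_inner_le_norm d (H d))).1
    have h2 := mul_le_mul_of_nonneg_left (H.le_opNorm d) hd.le
    nlinarith
  obtain ⟨c, hc1, hcg, hc⟩ : ∃ c : ℝ, c ^ 2 = 1 ∧ 0 ≤ c * inner ℝ d g ∧
      ncDirection H g d = (-(c * (-q / ‖d‖ ^ 3))) • d := by
    by_cases hs : 0 ≤ inner ℝ d g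
    · exact ⟨1, by norm_num, by simpa using hs, by
        simp only [ncDirection, ← hq, hs, if_true, abs_of_neg hq0]; congr 1; ring⟩
    · exact ⟨-1, by norm_num, by linarith, by
        simp only [ncDirection, ← hq, hs, if_false, abs_of_neg hq0]; congr 1; ring⟩
  have hcabs : |c| = 1 := by
    rw [← sq_abs] at hc1
    nlinarith [abs_nonneg c]
  have hnorm : ‖ncDirection H g d‖ = -q / ‖d‖ ^ 2 := by
    rw [hc, norm_smul, Real.norm_eq_abs, abs_neg, abs_mul, hcabs, one_mul,
      abs_of_nonneg (by apply div_nonneg <;> [linarith; positivity])]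
    field_simp
  rw [hnorm]
  refine ⟨?_, ?_, ?_, ?_⟩
  · rw [le_div_iff₀ (by positivity)]
    linarith
  · rw [hc]
    simp only [map_smul, inner_smul_left, inner_smul_right, conj_trivial, ← hq]
    have : -(c * (-q / ‖d‖ ^ 3)) * (-(c * (-q / ‖d‖ ^ 3)) * q) =
      c ^ 2 * ((-q / ‖d‖ ^ 3) ^ 2 * q) := by ring
    rw [this, hc1]
    field_simp
  · rw [hc, inner_smul_right, real_inner_comm]
    have : 0 ≤ -q / ‖d‖ ^ 3 := by apply div_nonneg <;> [linarith; positivity]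
    nlinarith
  · rw [div_le_iff₀ (by positivity)]
    exact hqle

/-- A trial step rejected along a negative curvature direction is long. -/
theorem nc_rejected {η t : ℝ} (ht : 0 < t) {x e : EuclideanSpace ℝ (Fin n)} (he : e ≠ 0)
    (hcurv : inner ℝ e (hess f x e) = -‖e‖ ^ 3) (hdesc : inner ℝ (gradient f x) e ≤ 0)
    (hrej : ¬ f (x + t • e) < f x - η / 2 * t ^ 2 * ‖e‖ ^ 3) :
    (1 - η) * ‖e‖ ≤ estimatorZero f ν (x + t • e) x * (t * ‖e‖) ^ ν := by
  have hp := norm_pos_iff.2 he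
  have h1 := taylor_upper (f := f) (ν := ν) (x := x) (smul_ne_zero ht.ne' he)
  rw [inner_smul_right, map_smul, inner_smul_left, inner_smul_right, hcurv, norm_smul,
    Real.norm_of_nonneg ht.le, Real.rpow_add (by positivity), Real.rpow_two] at h1
  simp only [conj_trivial] at h1
  have h2 : t * inner ℝ (gradient f x) e ≤ 0 := mul_nonpos_of_nonneg_of_nonpos ht.le hdesc
  have h3 : (t * ‖e‖) ^ 2 * ((1 - η) * ‖e‖) ≤
      (t * ‖e‖) ^ 2 * (estimatorZero f ν (x + t • e) x * (t * ‖e‖) ^ ν) := by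
    push Not at hrej
    nlinarith
  exact le_of_mul_le_mul_left h3 (by positivity)

/-- A trial step rejected along a damped Newton direction is long. -/
theorem sol_rejected {η σ t : ℝ} (hσ : 0 ≤ σ) (ht : 0 < t) (ht1 : t ≤ 1)
    {x d : EuclideanSpace ℝ (Fin n)} (hd : d ≠ 0)
    (hcurv : σ * ‖d‖ ^ 2 ≤ inner ℝ d (damped (hess f x) σ d))
    (horth : inner ℝ d (gradient f x + damped (hess f x) σ d) = 0)
    (hrej : ¬ f (x + t • d) < f x - η * σ * t * ‖d‖ ^ 2)
    (hest : 0 ≤ estimatorZero f ν (x + t • d) x) :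
    (1 - η) * σ * ‖d‖ ≤ estimatorZero f ν (x + t • d) x * (t * ‖d‖) ^ (1 + ν) := by
  have hp := norm_pos_iff.2 hd
  have h1 := taylor_upper (f := f) (ν := ν) (x := x) (smul_ne_zero ht.ne' hd)
  rw [inner_add_right] at horth
  have h0 : inner ℝ d (damped (hess f x) σ d) = inner ℝ d (hess f x d) + 2 * σ * ‖d‖ ^ 2 := by
    rw [damped_apply, inner_add_right, inner_smul_right, real_inner_self_eq_norm_sq]
  rw [inner_smul_right, map_smul, inner_smul_left, inner_smul_right, norm_smul,
    Real.norm_of_nonneg ht.le, real_inner_comm,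
    show (2 : ℝ) + ν = 1 + (1 + ν) by ring, Real.rpow_add (by positivity), Real.rpow_one] at h1
  simp only [conj_trivial] at h1
  set q := inner ℝ d (damped (hess f x) σ d)
  have hg : inner ℝ d (gradient f x) = -q := by linarith
  have hH : inner ℝ d (hess f x d) = q - 2 * σ * ‖d‖ ^ 2 := by linarith
  rw [hg, hH] at h1
  set m := estimatorZero f ν (x + t • d) x * (t * ‖d‖) ^ (1 + ν) with hm
  have hm0 : 0 ≤ m := by positivity
  push Not at hrej
  have h2 : t * (1 - t / 2) * (σ * ‖d‖ ^ 2) ≤ t * (1 - t / 2) * q :=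
    mul_le_mul_of_nonneg_left hcurv (mul_nonneg ht.le (by linarith))
  have h4 : 1 / 2 * estimatorZero f ν (x + t • d) x * (t * ‖d‖ * (t * ‖d‖) ^ (1 + ν)) =
      t * ‖d‖ * (1 / 2 * m) := by rw [hm]; ring
  rw [h4] at h1
  -- With `q` the damped curvature, the quadratic model changes by `-t (1 - t/2) q - t² σ ‖d‖²`. As
  -- `t ≤ 1` and `q ≥ σ ‖d‖²`, it decreases by at least `t σ ‖d‖²`, so rejection forces the
  -- remainder to make up the fraction `1 - η`.
  have h5 : t * ‖d‖ * ((1 - η) * σ * ‖d‖) ≤ t * ‖d‖ * (1 / 2 * m) := by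
    have h6 : 0 ≤ t ^ 2 * (σ * ‖d‖ ^ 2) := by positivity
    nlinarith
  have h6 := le_of_mul_le_mul_left h5 (by positivity)
  linarith

end Calculus

/-! ### One iteration: feasibility, bounds on the estimate, guaranteed decrease. -/

section Step

variable {n : ℕ} {f : EuclideanSpace ℝ (Fin n) → ℝ} {x₀ : EuclideanSpace ℝ (Fin n)}
  {ν η θ Hf Ug UH fLow : ℝ}

theorem damping_pos {γ : ℝ} (hγ : 0 < γ) {g : EuclideanSpace ℝ (Fin n)} (hg : g ≠ 0) :
    0 < damping ν γ g := by
  have := norm_pos_iff.2 hg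
  unfold damping
  positivity

theorem accuracy_nonneg {g : EuclideanSpace ℝ (Fin n)} : 0 ≤ accuracy ν g :=
  le_min (by norm_num) (by positivity)

theorem accuracy_le {g : EuclideanSpace ℝ (Fin n)} : accuracy ν g ≤ 1 / 2 := min_le_left _ _

/-- With `damping * ‖d‖ ≤ ‖g‖` this gives `‖d‖ ≤ max 1 ‖g‖`, which keeps Newton trial steps inside
the neighbourhood where the Hölder condition is assumed. -/
theorem min_one_norm_le_damping (hν : 0 < ν) {γ : ℝ} (hγ : 1 ≤ γ)
    (g : EuclideanSpace ℝ (Fin n)) : min 1 ‖g‖ ≤ damping ν γ g := by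
  have h1 : (‖g‖ ^ ν) ^ (1 / (1 + ν)) ≤ damping ν γ g := by
    unfold damping
    gcongr
    exact le_mul_of_one_le_left (by positivity) hγ
  refine le_trans ?_ h1
  rw [← Real.rpow_mul (norm_nonneg _)]
  have e1 : 0 ≤ ν * (1 / (1 + ν)) := by positivity
  have e2 : ν * (1 / (1 + ν)) ≤ 1 := by
    rw [mul_one_div, div_le_one (by linarith)]
    linarith
  rcases le_total ‖g‖ 1 with h | h
  · refine (min_le_right _ _).trans ?_
    rcases eq_or_ne g 0 with rfl | hg
    · simpa using Real.rpow_nonneg le_rfl _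
    · simpa using Real.rpow_le_rpow_of_exponent_ge (norm_pos_iff.2 hg) h e2
  · exact (min_le_left _ _).trans (Real.one_le_rpow h e1)

theorem StandingAssumptions.nc_direction (S : StandingAssumptions f x₀ ν Hf Ug UH fLow)
    {x : EuclideanSpace ℝ (Fin n)} (hx : x ∈ levelSet f x₀) {γ : ℝ} (hγ : 1 ≤ γ)
    (hg : gradient f x ≠ 0) {d e : EuclideanSpace ℝ (Fin n)}
    (hd : CappedCG (hess f x) (gradient f x) (accuracy ν (gradient f x))
        (damping ν γ (gradient f x)) d CGType.nc)
    (he : e = ncDirection (hess f x) (gradient f x) d) :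
    damping ν γ (gradient f x) ≤ ‖e‖ ∧ e ≠ 0 ∧ inner ℝ e (hess f x e) = -‖e‖ ^ 3 ∧
      inner ℝ (gradient f x) e ≤ 0 ∧ ‖e‖ ≤ max (1.1 : ℝ) (max (1.1 * Ug) UH) := by
  subst he
  have h0 := damping_pos (ν := ν) (zero_lt_one.trans_le hγ) hg
  obtain ⟨h1, h2, h3, h4⟩ := ncDirection_properties (g := gradient f x) h0 hd.lowCurvature
  exact ⟨h1, norm_pos_iff.1 (h0.trans_le h1), h2, h3,
    (h4.trans (S.hess_bound x hx)).trans (by simp)⟩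

theorem StandingAssumptions.sol_direction (S : StandingAssumptions f x₀ ν Hf Ug UH fLow)
    (hν : 0 < ν) {x : EuclideanSpace ℝ (Fin n)} (hx : x ∈ levelSet f x₀) {γ : ℝ} (hγ : 1 ≤ γ)
    (hg : gradient f x ≠ 0) {d : EuclideanSpace ℝ (Fin n)}
    (h : damping ν γ (gradient f x) * ‖d‖ ≤ ‖gradient f x‖) :
    ‖d‖ ≤ max (1.1 : ℝ) (max (1.1 * Ug) UH) := by
  have h1 := mul_le_mul_of_nonneg_right (min_one_norm_le_damping hν hγ (gradient f x))
    (norm_nonneg d)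
  have h2 := S.gradient_bound x hx
  have hp := norm_pos_iff.2 hg
  have h3 := S.Ug_pos
  rcases le_total ‖gradient f x‖ 1 with h4 | h4
  · rw [min_eq_right h4] at h1
    have : ‖d‖ ≤ 1 := by
      have : ‖gradient f x‖ * ‖d‖ ≤ ‖gradient f x‖ * 1 := by linarith
      exact le_of_mul_le_mul_left this hp
    exact le_max_of_le_left (by linarith)
  · rw [min_eq_left h4] at h1
    exact le_max_of_le_right (le_max_of_le_left (by linarith))

theorem norm_smul_pow_le {e : EuclideanSpace ℝ (Fin n)} {r : ℝ} (hθ₀ : 0 < θ) (hθ₁ : θ < 1)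
    (he : ‖e‖ ≤ r) (j : ℕ) : ‖θ ^ j • e‖ ≤ r := by
  rw [norm_smul, Real.norm_of_nonneg (by positivity)]
  exact (mul_le_of_le_one_left (norm_nonneg _) (pow_le_one₀ hθ₀.le hθ₁.le)).trans he

theorem estimatorZero_nonneg (y x : EuclideanSpace ℝ (Fin n)) : 0 ≤ estimatorZero f ν y x := by
  unfold estimatorZero residualZero
  positivity

/-- Termination of both line searches: the right side tends to zero with the trial step. -/
theorem not_forall_le_mul_rpow {a b c μ : ℝ} (hμ : 0 < μ) (ha : 0 < a) (hθ₀ : 0 < θ)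
    (hθ₁ : θ < 1) : ¬ ∀ j : ℕ, a ≤ b * (θ ^ j * c) ^ μ := by
  intro h
  have h1 : Filter.Tendsto (fun j : ℕ => θ ^ j * c) Filter.atTop (nhds 0) := by
    simpa using (tendsto_pow_atTop_nhds_zero_of_lt_one hθ₀.le hθ₁).mul_const c
  have h2 := (h1.rpow_const (p := μ) (Or.inr hμ.le)).const_mul b
  rw [Real.zero_rpow hμ.ne', mul_zero] at h2
  exact absurd (ge_of_tendsto' h2 h) (not_le.2 ha)

/-- Every iteration at a nonstationary point can be carried out. -/
theorem StandingAssumptions.exists_step (S : StandingAssumptions f x₀ ν Hf Ug UH fLow)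
    (hν : 0 < ν) (hη₁ : η < 1) (hθ₀ : 0 < θ) (hθ₁ : θ < 1)
    {x : EuclideanSpace ℝ (Fin n)} (hx : x ∈ levelSet f x₀) {γ : ℝ} (hγ : 1 ≤ γ)
    (hg : gradient f x ≠ 0) : ∃ x' γ', NewtonCGStep f ν η θ x γ x' γ' := by
  have hε := damping_pos (ν := ν) (zero_lt_one.trans_le hγ) hg
  obtain ⟨d, t, hd⟩ := exists_cappedCG hε accuracy_nonneg hg (hess_symm S.contDiff x)
    (ζ := accuracy ν (gradient f x))
  cases t with
  | nc =>
    obtain ⟨-, he0, hc, hdesc, hr⟩ := S.nc_direction hx hγ hg hd rfl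
    set e := ncDirection (hess f x) (gradient f x) d with he
    have hne : (acceptNC f η θ x e).Nonempty := by
      by_contra hcon
      have hp := norm_pos_iff.2 he0
      refine not_forall_le_mul_rpow (a := (1 - η) * ‖e‖) (b := 2 * Hf) (c := ‖e‖) hν
        (mul_pos (by linarith) hp) hθ₀ hθ₁ fun j => ?_
      have h1 : ¬ f (x + θ ^ j • e) < f x - η / 2 * (θ ^ j) ^ 2 * ‖e‖ ^ 3 := fun h =>
        hcon ⟨j, by rw [← pow_mul, mul_comm j] at h; exact h⟩
      refine (nc_rejected (ν := ν) (by positivity) he0 hc hdesc h1).trans ?_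
      gcongr
      exact S.estimatorZero_le hν hx (norm_smul_pow_le hθ₀ hθ₁ hr j)
        (smul_ne_zero (by positivity) he0)
    exact ⟨_, _, .nc d e _ hd he ⟨Nat.sInf_mem hne, fun _ h => Nat.sInf_le h⟩⟩
  | sol =>
    obtain ⟨hc, ho, -, hn, hd0⟩ := hd.sol_properties hε accuracy_nonneg accuracy_le hg
      (hess_symm S.contDiff x)
    have hr := S.sol_direction hν hx hγ hg hn
    have hne : (acceptSOL f η θ (damping ν γ (gradient f x)) x d).Nonempty := by
      by_contra hcon
      have hp := norm_pos_iff.2 hd0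
      refine not_forall_le_mul_rpow (a := (1 - η) * damping ν γ (gradient f x) * ‖d‖)
        (b := 2 * Hf) (c := ‖d‖) (μ := 1 + ν) (by linarith)
        (mul_pos (mul_pos (by linarith) hε) hp) hθ₀ hθ₁ fun j => ?_
      refine (sol_rejected (ν := ν) hε.le (by positivity) (pow_le_one₀ hθ₀.le hθ₁.le) hd0 hc ho
        (fun h => hcon ⟨j, h⟩) (estimatorZero_nonneg _ _)).trans ?_
      gcongr
      exact S.estimatorZero_le hν hx (norm_smul_pow_le hθ₀ hθ₁ hr j)
        (smul_ne_zero (by positivity) hd0)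
    exact ⟨_, _, .sol d _ hd ⟨Nat.sInf_mem hne, fun _ h => Nat.sInf_le h⟩⟩

theorem StandingAssumptions.step_bounds (S : StandingAssumptions f x₀ ν Hf Ug UH fLow)
    (hν : 0 < ν) (hη₀ : 0 < η) (hθ₀ : 0 < θ) (hθ₁ : θ < 1)
    {x : EuclideanSpace ℝ (Fin n)} (hx : x ∈ levelSet f x₀) {γ : ℝ} (hγ : 1 ≤ γ)
    (hg : gradient f x ≠ 0) {x' : EuclideanSpace ℝ (Fin n)} {γ' : ℝ}
    (h : NewtonCGStep f ν η θ x γ x' γ') :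
    f x' < f x ∧ γ ≤ γ' ∧ γ' ≤ max γ (2 * Hf) := by
  have hε := damping_pos (ν := ν) (zero_lt_one.trans_le hγ) hg
  cases h with
  | nc d e j hd he hj =>
    obtain ⟨-, he0, -, -, hr⟩ := S.nc_direction hx hγ hg hd he
    refine ⟨hj.1.trans_le (sub_le_self _ (by positivity)), ?_, ?_⟩
    · split_ifs
      exacts [le_max_left _ _, le_rfl]
    · split_ifs
      · exact max_le_max le_rfl (S.estimatorZero_le hν hx (norm_smul_pow_le hθ₀ hθ₁ hr _)
          (smul_ne_zero (by positivity) he0))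
      · exact le_max_left _ _
  | sol d j hd hj =>
    obtain ⟨-, -, -, hn, hd0⟩ := hd.sol_properties hε accuracy_nonneg accuracy_le hg
      (hess_symm S.contDiff x)
    have hr := S.sol_direction hν hx hγ hg hn
    refine ⟨hj.1.trans_le (sub_le_self _ (by positivity)), le_max_left _ _,
      max_le_max le_rfl ?_⟩
    split_ifs
    · exact S.estimatorOne_le hν hx hr hd0
    · exact max_le (S.estimatorZero_le hν hx hr hd0) (S.estimatorZero_le hν hx
        (norm_smul_pow_le hθ₀ hθ₁ hr _) (smul_ne_zero (by positivity) hd0))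

/-- A lower bound for the damping parameter. -/
theorem mul_rpow_le_damping (hν : 0 < ν) {γ Γ δ : ℝ} (hΓ : 0 < Γ) (hδ : 0 < δ) (hΓγ : Γ ≤ γ)
    {g : EuclideanSpace ℝ (Fin n)} (hg : Γ * δ ^ (1 + ν) ≤ ‖g‖) :
    Γ * δ ^ ν ≤ damping ν γ g := by
  have e : Γ * δ ^ ν = (Γ * (Γ * δ ^ (1 + ν)) ^ ν) ^ (1 / (1 + ν)) := by
    have h1 : Γ * (Γ * δ ^ (1 + ν)) ^ ν = (Γ * δ ^ ν) ^ (1 + ν) := by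
      rw [Real.mul_rpow hΓ.le (by positivity), Real.mul_rpow hΓ.le (by positivity),
        Real.rpow_add hΓ, Real.rpow_one, ← Real.rpow_mul hδ.le, ← Real.rpow_mul hδ.le]
      ring_nf
    rw [h1, ← Real.rpow_mul (by positivity), mul_one_div_cancel (by linarith), Real.rpow_one]
  rw [e]
  have hγ : 0 ≤ γ := hΓ.le.trans hΓγ
  unfold damping
  gcongr

/-- The guaranteed decrease, in units of `Γ δ^(2+ν)`. -/
noncomputable def decreaseConst (ν η θ ρ : ℝ) : ℝ :=
  min (η / 2 * θ ^ 2 * (((1 - η) / 2) ^ (1 / ν)) ^ 2) (η * ρ ^ 2)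

/-- A step either decreases the objective substantially, or it is a short damped Newton step. -/
theorem StandingAssumptions.step_dichotomy (S : StandingAssumptions f x₀ ν Hf Ug UH fLow)
    (hν : 0 < ν) (hν₁ : ν ≤ 1) (hη₀ : 0 < η) (hη₁ : η < 1) (hθ₀ : 0 < θ) (hθ₁ : θ < 1)
    {x : EuclideanSpace ℝ (Fin n)} (hx : x ∈ levelSet f x₀) {γ : ℝ}
    (hg : gradient f x ≠ 0) {x' : EuclideanSpace ℝ (Fin n)} {γ' : ℝ}
    (h : NewtonCGStep f ν η θ x γ x' γ') {Γ δ ρ : ℝ} (hΓ : 1 ≤ Γ) (hδ₀ : 0 < δ) (hδ₁ : δ ≤ 1)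
    (hρ : 0 < ρ) (hΓγ : Γ ≤ γ) (hΓγ' : γ' ≤ 2 * Γ) (hgδ : Γ * δ ^ (1 + ν) ≤ ‖gradient f x‖) :
    decreaseConst ν η θ ρ * (Γ * δ ^ (2 + ν)) ≤ f x - f x' ∨
      ‖x' - x‖ ≤ ρ * δ ∧
      ‖gradient f x' + (2 * damping ν γ (gradient f x)) • (x' - x)‖ ≤
        1 / 4 * damping ν γ (gradient f x) * ‖x' - x‖ + 2 * Γ * ‖x' - x‖ ^ (1 + ν) ∧
      ‖gradient f x' - gradient f x - hess f x (x' - x)‖ ≤ 2 * Γ * ‖x' - x‖ ^ (1 + ν) := by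
  have hγ : 1 ≤ γ := hΓ.trans hΓγ
  have hε := damping_pos (ν := ν) (zero_lt_one.trans_le hγ) hg
  have hεl := mul_rpow_le_damping hν (zero_lt_one.trans_le hΓ) hδ₀ hΓγ hgδ
  have hΓ0 : 0 < Γ := by linarith
  set c := ((1 - η) / 2) ^ (1 / ν) with hc
  have hη' : 0 < (1 - η) / 2 := by linarith
  have hcpos : 0 < c := by positivity
  have hc1 : c ≤ 1 := Real.rpow_le_one hη'.le (by linarith) (by positivity)
  have hcν : c ^ ν = (1 - η) / 2 := by
    rw [hc, ← Real.rpow_mul hη'.le, one_div_mul_cancel hν.ne', Real.rpow_one]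
  have hδν : δ ≤ δ ^ ν := by
    simpa using Real.rpow_le_rpow_of_exponent_ge hδ₀ hδ₁ hν₁
  have htarget : Γ * δ ^ (2 + ν) = Γ * δ ^ ν * δ ^ 2 := by
    rw [Real.rpow_add hδ₀, Real.rpow_two]
    ring
  rw [htarget]
  set e₀ := Γ * δ ^ ν with he₀
  have he₀pos : 0 < e₀ := by positivity
  -- This is where `δ ≤ 1`, `ν ≤ 1` and `Γ ≥ 1` enter: a negative curvature step has length at least
  -- `e₀`, hence at least `δ`.
  have hδe₀ : δ ≤ e₀ := hδν.trans (le_mul_of_one_le_left (by positivity) hΓ)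
  set ε := damping ν γ (gradient f x) with hεdef
  have hA1 : decreaseConst ν η θ ρ ≤ η / 2 * θ ^ 2 * c ^ 2 := min_le_left _ _
  have hA2 : decreaseConst ν η θ ρ ≤ η * ρ ^ 2 := min_le_right _ _
  have hA3 : decreaseConst ν η θ ρ ≤ η / 2 := by
    refine hA1.trans ?_
    have : θ ^ 2 * c ^ 2 ≤ 1 := mul_le_one₀ (pow_le_one₀ hθ₀.le hθ₁.le) (by positivity)
      (pow_le_one₀ hcpos.le hc1)
    nlinarith
  cases h with
  | nc d e j hd he hj =>
    left
    obtain ⟨hle, he0, hcurv, hdesc, -⟩ := S.nc_direction hx hγ hg hd he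
    have hp := norm_pos_iff.2 he0
    have hacc : f (x + θ ^ j • e) < f x - η / 2 * θ ^ (2 * j) * ‖e‖ ^ 3 := hj.1
    have hele : e₀ ≤ ‖e‖ := hεl.trans hle
    suffices hsuff : decreaseConst ν η θ ρ * (e₀ * δ ^ 2) ≤ η / 2 * θ ^ (2 * j) * ‖e‖ ^ 3 by
      linarith
    rcases j with _ | j
    · have : e₀ * δ ^ 2 ≤ ‖e‖ ^ 3 := by
        calc e₀ * δ ^ 2 ≤ ‖e‖ * ‖e‖ ^ 2 := by
              gcongr
              exact hδe₀.trans hele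
          _ = _ := by ring
      calc _ ≤ η / 2 * ‖e‖ ^ 3 := by gcongr
        _ = _ := by simp
    · have hrej : ¬ f (x + θ ^ j • e) < f x - η / 2 * (θ ^ j) ^ 2 * ‖e‖ ^ 3 := fun h => by
        have := hj.2 (show j ∈ acceptNC f η θ x e by
          rw [← pow_mul, mul_comm j] at h
          exact h)
        omega
      have h1 := nc_rejected (ν := ν) (by positivity) he0 hcurv hdesc hrej
      -- The estimator at the last rejected trial is part of `γ'`, so the assumption that the
      -- estimate did not double replaces knowledge of `Hf`.
      have hest : estimatorZero f ν (x + θ ^ j • e) x ≤ 2 * Γ := by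
        refine le_trans ?_ hΓγ'
        simp
      have h2 : (1 - η) * ‖e‖ ≤ 2 * Γ * (θ ^ j * ‖e‖) ^ ν := h1.trans (by gcongr)
      have h3 : (c * δ) ^ ν ≤ (θ ^ j * ‖e‖) ^ ν := by
        rw [Real.mul_rpow hcpos.le hδ₀.le, hcν]
        have h4 : (1 - η) * e₀ ≤ (1 - η) * ‖e‖ := by
          apply mul_le_mul_of_nonneg_left hele
          linarith
        have h5 : 2 * Γ * ((1 - η) / 2 * δ ^ ν) ≤ 2 * Γ * (θ ^ j * ‖e‖) ^ ν := by
          rw [he₀] at h4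
          linarith
        exact le_of_mul_le_mul_left h5 (by positivity)
      have h6 : c * δ ≤ θ ^ j * ‖e‖ :=
        (Real.rpow_le_rpow_iff (by positivity) (by positivity) hν).1 h3
      calc _ ≤ η / 2 * θ ^ 2 * c ^ 2 * (e₀ * δ ^ 2) := by gcongr
        _ = η / 2 * θ ^ 2 * (e₀ * (c * δ) ^ 2) := by ring
        _ ≤ η / 2 * θ ^ 2 * (‖e‖ * (θ ^ j * ‖e‖) ^ 2) := by gcongr
        _ = _ := by ring
  | sol d j hd hj =>
    obtain ⟨hcurv, horth, hres, -, hd0⟩ := hd.sol_properties hε accuracy_nonneg accuracy_le hg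
      (hess_symm S.contDiff x)
    have hp := norm_pos_iff.2 hd0
    have hacc : f (x + θ ^ j • d) < f x - η * ε * θ ^ j * ‖d‖ ^ 2 := hj.1
    rcases j with _ | j
    · have hest : estimatorOne f ν (x + d) x ≤ 2 * Γ := by
        refine le_trans ?_ hΓγ'
        simp
      by_cases hlong : ρ * δ ≤ ‖d‖
      · left
        have : decreaseConst ν η θ ρ * (e₀ * δ ^ 2) ≤ η * ε * ‖d‖ ^ 2 := by
          calc _ ≤ η * ρ ^ 2 * (e₀ * δ ^ 2) := by gcongr
            _ = η * e₀ * (ρ * δ) ^ 2 := by ring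
            _ ≤ _ := by gcongr
        simp only [pow_zero, one_smul, mul_one] at hacc ⊢
        linarith
      · right
        simp only [pow_zero, one_smul, add_sub_cancel_left]
        have h1 : ‖gradient f (x + d) - gradient f x - hess f x d‖ ≤ 2 * Γ * ‖d‖ ^ (1 + ν) := by
          rw [residualOne_eq (ν := ν) hd0]
          gcongr
        refine ⟨(not_le.1 hlong).le, ?_, h1⟩
        have e1 : gradient f (x + d) + (2 * ε) • d =
            (gradient f x + damped (hess f x) ε d) +
              (gradient f (x + d) - gradient f x - hess f x d) := by
          rw [damped_apply]
          abel
        rw [e1]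
        exact (norm_add_le _ _).trans (add_le_add hres h1)
    · left
      have hrej : ∀ i ≤ j, ¬ f (x + θ ^ i • d) < f x - η * ε * θ ^ i * ‖d‖ ^ 2 :=
        fun i hi h => by
          have := hj.2 (show i ∈ acceptSOL f η θ ε x d from h)
          omega
      have hmax := (le_max_right γ _).trans hΓγ'
      rw [if_neg (Nat.succ_ne_zero j), Nat.add_sub_cancel] at hmax
      have hrej0 := hrej 0 (Nat.zero_le _)
      rw [pow_zero] at hrej0
      have h1 := sol_rejected (ν := ν) hε.le one_pos le_rfl hd0 hcurv horth hrej0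
        (estimatorZero_nonneg _ _)
      have h2 := sol_rejected (ν := ν) hε.le (by positivity) (pow_le_one₀ hθ₀.le hθ₁.le) hd0 hcurv
        horth (hrej j le_rfl) (estimatorZero_nonneg _ _)
      rw [one_smul, one_mul] at h1
      have hη1 : 0 < 1 - η := by linarith
      have h3 : (1 - η) * ε * ‖d‖ ≤ 2 * Γ * ‖d‖ ^ (1 + ν) := h1.trans (by
        gcongr
        exact (le_max_left _ _).trans hmax)
      have h4 : (1 - η) * ε * ‖d‖ ≤ 2 * Γ * (θ ^ j * ‖d‖) ^ (1 + ν) := h2.trans (by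
        gcongr
        exact (le_max_right _ _).trans hmax)
      -- Two rejections are used in turn. The full trial bounds `‖d‖` from below; this bound,
      -- inserted in the inequality of the last rejected trial, bounds `θ ^ j * ‖d‖`, since there
      -- the exponent is `1 + ν` but only one factor `‖d‖` is on the left.
      have h5 : c * δ ≤ ‖d‖ := by
        refine (Real.rpow_le_rpow_iff (by positivity) (by positivity) hν).1 ?_
        rw [Real.mul_rpow hcpos.le hδ₀.le, hcν]
        rw [Real.rpow_add hp, Real.rpow_one] at h3
        have h6 : (1 - η) * e₀ * ‖d‖ ≤ (1 - η) * ε * ‖d‖ := by gcongr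
        have h7 : 2 * Γ * ‖d‖ * ((1 - η) / 2 * δ ^ ν) ≤ 2 * Γ * ‖d‖ * ‖d‖ ^ ν := by
          rw [he₀] at h6
          linarith
        exact le_of_mul_le_mul_left h7 (by positivity)
      have h8 : c * δ ≤ θ ^ j * ‖d‖ := by
        refine (Real.rpow_le_rpow_iff (by positivity) (by positivity)
          (by linarith : 0 < 1 + ν)).1 ?_
        rw [Real.rpow_add (by positivity), Real.rpow_one, Real.mul_rpow hcpos.le hδ₀.le, hcν]
        have h6 : (1 - η) * e₀ * (c * δ) ≤ (1 - η) * ε * ‖d‖ := by gcongr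
        have h7 : 2 * Γ * (c * δ * ((1 - η) / 2 * δ ^ ν)) ≤
            2 * Γ * (θ ^ j * ‖d‖) ^ (1 + ν) := by
          rw [he₀] at h6
          linarith
        exact le_of_mul_le_mul_left h7 (by positivity)
      have : decreaseConst ν η θ ρ * (e₀ * δ ^ 2) ≤ η * ε * θ ^ (j + 1) * ‖d‖ ^ 2 := by
        calc _ ≤ η / 2 * θ ^ 2 * c ^ 2 * (e₀ * δ ^ 2) := by gcongr
          _ = η * θ * (θ / 2) * (e₀ * (c * δ) * (c * δ)) := by ring
          _ ≤ η * θ * 1 * (ε * (θ ^ j * ‖d‖) * ‖d‖) := by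
            gcongr
            linarith
          _ = _ := by ring
      linarith

end Step

/-! ### Chains of short steps and linear independence. -/

section LinearAlgebra

variable {n : ℕ}

theorem sum_range_ite_pow_le (N i : ℕ) :
    ∑ j ∈ Finset.range N, (if j < i then (8 : ℝ) ^ j else 0) ≤ 8 ^ i / 7 := by
  rw [← Finset.sum_filter]
  calc ∑ j ∈ (Finset.range N).filter (· < i), (8 : ℝ) ^ j
      ≤ ∑ j ∈ Finset.range i, (8 : ℝ) ^ j :=
        Finset.sum_le_sum_of_subset_of_nonneg
          (fun j hj => Finset.mem_range.2 (Finset.mem_filter.1 hj).2) fun _ _ _ => by positivity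
    _ ≤ 8 ^ i / 7 := by
      rw [geom_sum_eq (by norm_num)]
      linarith

/-- Vectors that form with another family a nearly triangular matrix of inner products, with
diagonal bounded below, are linearly independent. -/
theorem linearIndependent_of_nearly_triangular {N : ℕ} {μ : ℝ}
    (hμ : μ * (N * 8 ^ N) ≤ 1 / 14) (hμ0 : 0 ≤ μ)
    (a b : Fin N → EuclideanSpace ℝ (Fin n)) (ha : ∀ i, a i ≠ 0) (hb : ∀ i, b i ≠ 0)
    (hdiag : ∀ i, ‖a i‖ * ‖b i‖ ≤ 4 * |inner ℝ (a i) (b i)|)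
    (hupper : ∀ i j, i < j → |inner ℝ (a i) (b j)| ≤ μ * (‖a i‖ * ‖b j‖)) :
    LinearIndependent ℝ b := by
  rw [Fintype.linearIndependent_iff]
  intro c hc
  rcases isEmpty_or_nonempty (Fin N) with hN | hN
  · exact fun i => hN.elim i
  -- The row to test is the one maximizing the coefficients weighted by `8 ^ (-j)`. Entries below
  -- the diagonal are not small, but the weights sum them to at most `8 ^ i / 7`; against the
  -- diagonal bound `1/4` this leaves `4/7`, and the entries above it add at most `2/7`.
  obtain ⟨i, hi⟩ := Finite.exists_max fun j : Fin N => |c j| * ‖b j‖ / 8 ^ (j : ℕ)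
  set q := |c i| * ‖b i‖ / 8 ^ (i : ℕ) with hq
  have hqj : ∀ j, |c j| * ‖b j‖ ≤ q * 8 ^ (j : ℕ) := fun j =>
    (div_le_iff₀ (by positivity)).1 (hi j)
  have hqi : |c i| * ‖b i‖ = q * 8 ^ (i : ℕ) := by
    rw [hq]
    field_simp
  have hq0 : 0 ≤ q := by positivity
  have hai := norm_pos_iff.2 (ha i)
  suffices hzero : q = 0 by
    intro j
    have h1 := hqj j
    rw [hzero, zero_mul] at h1
    have h2 := norm_pos_iff.2 (hb j)
    have h3 : |c j| ≤ 0 := by nlinarith [abs_nonneg (c j)]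
    exact abs_eq_zero.1 (le_antisymm h3 (abs_nonneg _))
  have h1 : inner ℝ (a i) (∑ j, c j • b j) = 0 := by rw [hc, inner_zero_right]
  rw [inner_sum] at h1
  simp only [inner_smul_right] at h1
  rw [← Finset.add_sum_erase _ _ (Finset.mem_univ i)] at h1
  have h2 : |c i * inner ℝ (a i) (b i)| ≤
      ∑ j ∈ Finset.univ.erase i, |c j * inner ℝ (a i) (b j)| := by
    rw [eq_neg_of_add_eq_zero_left h1, abs_neg]
    exact Finset.abs_sum_le_sum_abs _ _
  have h3 : ∀ j ∈ Finset.univ.erase i, |c j * inner ℝ (a i) (b j)| ≤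
      ‖a i‖ * q * ((if (j : ℕ) < i then (8 : ℝ) ^ (j : ℕ) else 0) + μ * 8 ^ N) := by
    intro j hj
    have hji := (Finset.mem_erase.1 hj).1
    rw [abs_mul]
    have h0 := hqj j
    rcases lt_or_gt_of_ne hji with hlt | hlt
    · rw [if_pos (show (j : ℕ) < i from hlt)]
      calc |c j| * |inner ℝ (a i) (b j)| ≤ |c j| * (‖a i‖ * ‖b j‖) := by
            gcongr
            exact abs_real_inner_le_norm _ _
        _ = ‖a i‖ * (|c j| * ‖b j‖) := by ring
        _ ≤ ‖a i‖ * (q * 8 ^ (j : ℕ)) := by gcongr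
        _ ≤ ‖a i‖ * q * (8 ^ (j : ℕ) + μ * 8 ^ N) := by
            rw [← mul_assoc]
            gcongr
            exact le_add_of_nonneg_right (by positivity)
    · rw [if_neg (show ¬ (j : ℕ) < i from not_lt.2 (le_of_lt hlt)), zero_add]
      calc |c j| * |inner ℝ (a i) (b j)| ≤ |c j| * (μ * (‖a i‖ * ‖b j‖)) := by
            gcongr
            exact hupper i j hlt
        _ = ‖a i‖ * μ * (|c j| * ‖b j‖) := by ring
        _ ≤ ‖a i‖ * μ * (q * 8 ^ (j : ℕ)) := by gcongr
        _ ≤ ‖a i‖ * μ * (q * 8 ^ N) := by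
            gcongr
            · norm_num
            · exact j.2.le
        _ = _ := by ring
  have h4 : ∑ j ∈ Finset.univ.erase i, |c j * inner ℝ (a i) (b j)| ≤
      ‖a i‖ * q * (8 ^ (i : ℕ) / 7 + 1 / 14) := by
    refine (Finset.sum_le_sum h3).trans ?_
    rw [← Finset.mul_sum]
    refine mul_le_mul_of_nonneg_left ?_ (by positivity)
    refine (Finset.sum_le_sum_of_subset_of_nonneg (Finset.subset_univ _)
      fun j _ _ => ?_).trans ?_
    · split_ifs <;> positivity
    rw [Finset.sum_add_distrib, Finset.sum_const, Finset.card_univ, Fintype.card_fin,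
      nsmul_eq_mul]
    have := sum_range_ite_pow_le N i
    rw [← Fin.sum_univ_eq_sum_range (fun j => if j < (i : ℕ) then (8 : ℝ) ^ j else 0)] at this
    linarith
  have h5 : ‖a i‖ * (q * 8 ^ (i : ℕ)) ≤ 4 * |c i * inner ℝ (a i) (b i)| := by
    rw [← hqi, abs_mul]
    calc _ = |c i| * (‖a i‖ * ‖b i‖) := by ring
      _ ≤ |c i| * (4 * |inner ℝ (a i) (b i)|) :=
        mul_le_mul_of_nonneg_left (hdiag i) (abs_nonneg _)
      _ = _ := by ring
  have h6 : ‖a i‖ * (q * 8 ^ (i : ℕ)) ≤ ‖a i‖ * (4 * q * (8 ^ (i : ℕ) / 7 + 1 / 14)) := by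
    linarith
  have h7 := le_of_mul_le_mul_left h6 hai
  have h8 : (1 : ℝ) ≤ 8 ^ (i : ℕ) := one_le_pow₀ (by norm_num)
  nlinarith

/-- Comparison of the gradient and the step of a short damped Newton iteration. -/
theorem short_step_bounds {g' d : EuclideanSpace ℝ (Fin n)} {e ε ρ : ℝ} (he : 0 < e)
    (hρ : 0 ≤ ρ) (hρ1 : ρ ≤ 1 / 16) (hε : ε ≤ ‖g'‖)
    (h : ‖g' + (2 * e) • d‖ ≤ 1 / 4 * e * ‖d‖ + 2 * ρ * ε) :
    ‖g'‖ ≤ 3 * (e * ‖d‖) ∧ e * ‖d‖ ≤ ‖g'‖ ∧ ‖g'‖ * ‖d‖ ≤ 4 * |inner ℝ g' d| := by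
  have h1 : ‖(2 * e) • d‖ = 2 * (e * ‖d‖) := by
    rw [norm_smul, Real.norm_of_nonneg (by positivity)]
    ring
  have h2 : ‖g'‖ ≤ ‖g' + (2 * e) • d‖ + ‖(2 * e) • d‖ := by
    simpa using norm_sub_le (g' + (2 * e) • d) ((2 * e) • d)
  have h3 : ‖(2 * e) • d‖ ≤ ‖g' + (2 * e) • d‖ + ‖g'‖ := by
    simpa using norm_sub_le (g' + (2 * e) • d) g'
  have h4 : ρ * ε ≤ 1 / 16 * ‖g'‖ := by
    have := norm_nonneg g'
    calc ρ * ε ≤ ρ * ‖g'‖ := by gcongr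
      _ ≤ _ := by gcongr
  have hA : ‖g'‖ ≤ 3 * (e * ‖d‖) := by linarith
  refine ⟨hA, by linarith, ?_⟩
  have h5 : inner ℝ (g' + (2 * e) • d) d = inner ℝ g' d + 2 * e * ‖d‖ ^ 2 := by
    rw [inner_add_left, inner_smul_left, real_inner_self_eq_norm_sq]
    simp
  have h6 := (abs_le.1 (abs_real_inner_le_norm (g' + (2 * e) • d) d)).2
  have h7 := neg_abs_le (inner ℝ g' d)
  have hd := norm_nonneg d
  have h8 : ‖g' + (2 * e) • d‖ * ‖d‖ ≤ (1 / 4 * e * ‖d‖ + 1 / 8 * ‖g'‖) * ‖d‖ := by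
    gcongr
    linarith
  have h9 : ‖g'‖ * ‖d‖ ≤ 3 * (e * ‖d‖) * ‖d‖ := by gcongr
  nlinarith

/-- A long sequence of short damped Newton steps with rapidly decreasing gradients is impossible:
half of the steps would be linearly independent. -/
theorem no_long_chain {ρ ε : ℝ} (hρ : 0 < ρ) (hρ1 : 700 * ρ * ((n + 1) * 8 ^ (n + 1)) ≤ 1)
    (hε : 0 < ε) (g d : ℕ → EuclideanSpace ℝ (Fin n))
    (H : ℕ → EuclideanSpace ℝ (Fin n) →L[ℝ] EuclideanSpace ℝ (Fin n)) (e : ℕ → ℝ)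
    (hsymm : ∀ k v w, inner ℝ (H k v) w = inner ℝ v (H k w))
    (he : ∀ k < 2 * (n + 1), 0 < e k)
    (hg : ∀ k ≤ 2 * (n + 1), ε ≤ ‖g k‖)
    (h1 : ∀ k < 2 * (n + 1),
      ‖g (k + 1) + (2 * e k) • d k‖ ≤ 1 / 4 * e k * ‖d k‖ + 2 * ρ * ε)
    (h2 : ∀ k < 2 * (n + 1), ‖g (k + 1) - g k - H k (d k)‖ ≤ 2 * ρ * ε)
    (h3 : ∀ k < 2 * (n + 1), (e k * ‖d k‖) ^ 2 ≤ 4 * ρ ^ 2 * (ε * ‖g k‖))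
    (h4 : ∀ k l, k ≤ l → l < 2 * (n + 1) → e l ≤ 2 * e k)
    (h5 : ∀ k l, k ≤ l → l < 2 * (n + 1) → ‖H k - H l‖ ≤ e k) : False := by
  have hpow : (8 : ℝ) ≤ (n + 1) * 8 ^ (n + 1) := by
    have e1 : (1 : ℝ) ≤ 8 ^ n := one_le_pow₀ (by norm_num)
    have e2 : (0 : ℝ) ≤ n := Nat.cast_nonneg n
    rw [pow_succ]
    nlinarith
  have hρ2 : ρ ≤ 1 / 5600 := by nlinarith
  have hb : ∀ k < 2 * (n + 1), ‖g (k + 1)‖ ≤ 3 * (e k * ‖d k‖) ∧ e k * ‖d k‖ ≤ ‖g (k + 1)‖ ∧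
      ‖g (k + 1)‖ * ‖d k‖ ≤ 4 * |inner ℝ (g (k + 1)) (d k)| := fun k hk =>
    short_step_bounds (he k hk) hρ.le (by linarith) (hg (k + 1) (by omega)) (h1 k hk)
  have hgpos : ∀ k ≤ 2 * (n + 1), 0 < ‖g k‖ := fun k hk => hε.trans_le (hg k hk)
  -- The factor `ε` is kept here, not replaced by `‖g k‖`, because it has to cancel in `a3`.
  have hsq : ∀ k < 2 * (n + 1), ‖g (k + 1)‖ ^ 2 ≤ 36 * ρ ^ 2 * (ε * ‖g k‖) := by
    intro k hk
    have e1 := (hb k hk).1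
    have e2 := h3 k hk
    have e3 := pow_le_pow_left₀ (norm_nonneg _) e1 2
    rw [mul_pow] at e3
    linarith
  have hdrop : ∀ k < 2 * (n + 1), ‖g (k + 1)‖ ≤ 6 * ρ * ‖g k‖ := by
    intro k hk
    have e1 := hsq k hk
    have e2 := hg k (by omega)
    have e3 := norm_nonneg (g k)
    refine (pow_le_pow_iff_left₀ (norm_nonneg _) (by positivity) two_ne_zero).1 ?_
    calc _ ≤ 36 * ρ ^ 2 * (ε * ‖g k‖) := e1
      _ ≤ 36 * ρ ^ 2 * (‖g k‖ * ‖g k‖) := by gcongr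
      _ = _ := by ring
  have hanti : ∀ k l, k ≤ l → l ≤ 2 * (n + 1) → ‖g l‖ ≤ ‖g k‖ := by
    intro k l hkl hl
    induction l, hkl using Nat.le_induction with
    | base => exact le_rfl
    | succ l hkl ih =>
      have e1 := hdrop l (by omega)
      have e2 := norm_nonneg (g l)
      have e3 := ih (by omega)
      nlinarith
  have hdpos : ∀ k < 2 * (n + 1), 0 < ‖d k‖ := by
    intro k hk
    have e1 := (hb k hk).1
    have e2 := hgpos (k + 1) (by omega)
    have e3 := he k hk
    by_contra hcon
    have : ‖d k‖ = 0 := le_antisymm (not_lt.1 hcon) (norm_nonneg _)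
    rw [this] at e1
    linarith
  have hortho : ∀ k l, k < l → l < 2 * (n + 1) →
      |inner ℝ (g k) (d l)| ≤ 50 * ρ * (‖g k‖ * ‖d l‖) := by
    intro k l hkl hl
    have hk : k < 2 * (n + 1) := by omega
    set w := g (k + 1) - g k - H k (d k) with hw
    -- Taylor expansion of the gradient at step `k`, then symmetry moves `H k` onto `d l`, where it
    -- is exchanged for `H l`. Each of the four terms is small relative to `‖g k‖ * ‖d l‖`.
    have e1 : inner ℝ (g k) (d l) = inner ℝ (g (k + 1)) (d l) - inner ℝ w (d l) -
        (inner ℝ (d k) (H l (d l)) + inner ℝ (d k) ((H k - H l) (d l))) := by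
      have : g k = g (k + 1) - w - H k (d k) := by
        rw [hw]
        abel
      rw [this, inner_sub_left, inner_sub_left, hsymm, ← inner_add_right]
      simp
    have a1 : |inner ℝ (g (k + 1)) (d l)| ≤ 6 * ρ * ‖g k‖ * ‖d l‖ :=
      (abs_real_inner_le_norm _ _).trans (by gcongr; exact hdrop k hk)
    have a2 : |inner ℝ w (d l)| ≤ 2 * ρ * ‖g k‖ * ‖d l‖ :=
      (abs_real_inner_le_norm _ _).trans (by
        gcongr
        exact (h2 k hk).trans (by gcongr; exact hg k hk.le))
    have hHl : ‖H l (d l)‖ ≤ 2 * ‖g l‖ := by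
      have t1 : H l (d l) = g (l + 1) - g l - (g (l + 1) - g l - H l (d l)) := by abel
      have t2 := hdrop l hl
      have t3 := hg l hl.le
      have t4 : ρ * ε ≤ ρ * ‖g l‖ := by gcongr
      have t6 : ρ * ‖g l‖ ≤ 1 / 5600 * ‖g l‖ := by gcongr
      calc ‖H l (d l)‖ ≤ ‖g (l + 1) - g l‖ + ‖g (l + 1) - g l - H l (d l)‖ := by
            conv_lhs => rw [t1]
            exact norm_sub_le _ _
        _ ≤ (‖g (l + 1)‖ + ‖g l‖) + 2 * ρ * ε := add_le_add (norm_sub_le _ _) (h2 l hl)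
        _ ≤ _ := by nlinarith
    have hgl : ‖g l‖ ≤ ‖g (k + 1)‖ := hanti (k + 1) l hkl hl.le
    -- The next gradient is still above `ε`, so the later step `d l` cannot be too short; this
    -- converts `ε / e k` into a multiple of `‖d l‖`.
    have hdl : ε ≤ 6 * (e k * ‖d l‖) := by
      have t1 := (hb l hl).1
      have t2 := hg (l + 1) (by omega)
      have t3 : e l * ‖d l‖ ≤ 2 * e k * ‖d l‖ := by
        gcongr
        exact h4 k l hkl.le hl
      linarith
    have hek := he k hk
    have hdk := (hb k hk).2.1
    have a3 : |inner ℝ (d k) (H l (d l))| ≤ 432 * ρ ^ 2 * ‖g k‖ * ‖d l‖ := by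
      have t0 : ε * (‖d k‖ * ‖g l‖) ≤ ε * (216 * ρ ^ 2 * ‖g k‖ * ‖d l‖) := by
        calc ε * (‖d k‖ * ‖g l‖) ≤ 6 * (e k * ‖d l‖) * (‖d k‖ * ‖g l‖) := by gcongr
          _ = 6 * ‖d l‖ * ((e k * ‖d k‖) * ‖g l‖) := by ring
          _ ≤ 6 * ‖d l‖ * (‖g (k + 1)‖ * ‖g (k + 1)‖) := by gcongr
          _ = 6 * ‖d l‖ * ‖g (k + 1)‖ ^ 2 := by ring
          _ ≤ 6 * ‖d l‖ * (36 * ρ ^ 2 * (ε * ‖g k‖)) := by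
            gcongr
            exact hsq k hk
          _ = _ := by ring
      have t1 := le_of_mul_le_mul_left t0 hε
      calc _ ≤ ‖d k‖ * ‖H l (d l)‖ := abs_real_inner_le_norm _ _
        _ ≤ ‖d k‖ * (2 * ‖g l‖) := by gcongr
        _ ≤ _ := by linarith
    have a4 : |inner ℝ (d k) ((H k - H l) (d l))| ≤ 6 * ρ * ‖g k‖ * ‖d l‖ := by
      calc _ ≤ ‖d k‖ * ‖(H k - H l) (d l)‖ := abs_real_inner_le_norm _ _
        _ ≤ ‖d k‖ * (e k * ‖d l‖) := by
          gcongr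
          exact ((H k - H l).le_opNorm _).trans (by gcongr; exact h5 k l hkl.le hl)
        _ = e k * ‖d k‖ * ‖d l‖ := by ring
        _ ≤ 6 * ρ * ‖g k‖ * ‖d l‖ :=
          mul_le_mul_of_nonneg_right (hdk.trans (hdrop k hk)) (norm_nonneg _)
    rw [e1]
    have b1 := abs_sub (inner ℝ (g (k + 1)) (d l) - inner ℝ w (d l))
      (inner ℝ (d k) (H l (d l)) + inner ℝ (d k) ((H k - H l) (d l)))
    have b2 := abs_sub (inner ℝ (g (k + 1)) (d l)) (inner ℝ w (d l))
    have b3 := abs_add_le (inner ℝ (d k) (H l (d l))) (inner ℝ (d k) ((H k - H l) (d l)))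
    have b4 : 432 * ρ ^ 2 * ‖g k‖ * ‖d l‖ ≤ ρ * ‖g k‖ * ‖d l‖ := by
      gcongr
      nlinarith
    have b5 : 0 ≤ ρ * ‖g k‖ * ‖d l‖ := by positivity
    linarith
  -- Only every other step is used: `g (2 i + 1)` pairs strongly with `d (2 i)`, and `hortho` needs
  -- a step of strictly larger index than the gradient, which rules out `d (2 i + 1)`.
  have hli : LinearIndependent ℝ fun i : Fin (n + 1) => d (2 * i) := by
    refine linearIndependent_of_nearly_triangular (μ := 50 * ρ) ?_ (by positivity)
      (fun i => g (2 * i + 1)) _ ?_ ?_ ?_ ?_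
    · push_cast
      linarith
    · exact fun i => norm_pos_iff.1 (hgpos _ (by omega))
    · exact fun i => norm_pos_iff.1 (hdpos _ (by omega))
    · exact fun i => (hb _ (by omega)).2.2
    · exact fun i j hij => hortho _ _ (by have := Fin.lt_def.1 hij; omega) (by omega)
  have := hli.fintype_card_le_finrank
  simp at this

end LinearAlgebra

/-! ### Executions and the decrease over a window of iterations. -/

section Window

variable {n : ℕ} {f : EuclideanSpace ℝ (Fin n) → ℝ} {x₀ : EuclideanSpace ℝ (Fin n)}
  {ν η θ γ₀ Hf Ug UH fLow : ℝ} {x : ℕ → EuclideanSpace ℝ (Fin n)} {γ : ℕ → ℝ}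

theorem IsPartialRun.invariants (S : StandingAssumptions f x₀ ν Hf Ug UH fLow)
    (hν : 0 < ν) (hη₀ : 0 < η) (hθ₀ : 0 < θ) (hθ₁ : θ < 1) (hγ₀ : 1 ≤ γ₀) {N : ℕ}
    (h : IsPartialRun f ν η θ γ₀ x₀ N x γ) :
    ∀ k ≤ N, x k ∈ levelSet f x₀ ∧ 1 ≤ γ k ∧ γ k ≤ max γ₀ (2 * Hf) ∧
      (k < N → f (x (k + 1)) ≤ f (x k) ∧ γ k ≤ γ (k + 1) ∧
        (gradient f (x k) ≠ 0 → f (x (k + 1)) < f (x k))) := by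
  have hstep : ∀ k < N, x k ∈ levelSet f x₀ → 1 ≤ γ k → γ k ≤ max γ₀ (2 * Hf) →
      f (x (k + 1)) ≤ f (x k) ∧ γ k ≤ γ (k + 1) ∧
        (gradient f (x k) ≠ 0 → f (x (k + 1)) < f (x k)) ∧
        γ (k + 1) ≤ max γ₀ (2 * Hf) := by
    intro k hk h1 h2 h3
    by_cases hg : gradient f (x k) = 0
    · obtain ⟨e1, e2⟩ := (h.2.2 k hk).2 hg
      rw [e1, e2]
      exact ⟨le_rfl, le_rfl, fun h => absurd hg h, h3⟩
    · obtain ⟨e1, e2, e3⟩ := S.step_bounds hν hη₀ hθ₀ hθ₁ h1 h2 hg ((h.2.2 k hk).1 hg)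
      exact ⟨e1.le, e2, fun _ => e1, e3.trans (max_le h3 (le_max_right _ _))⟩
  have hinv : ∀ k ≤ N, x k ∈ levelSet f x₀ ∧ 1 ≤ γ k ∧ γ k ≤ max γ₀ (2 * Hf) := by
    intro k
    induction k with
    | zero =>
      intro _
      rw [h.1, h.2.1]
      exact ⟨le_refl (f x₀), hγ₀, le_max_left _ _⟩
    | succ k ih =>
      intro hk
      obtain ⟨h1, h2, h3⟩ := ih (by omega)
      obtain ⟨e1, e2, -, e3⟩ := hstep k hk h1 h2 h3
      exact ⟨e1.trans h1, h2.trans e2, e3⟩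
  intro k hk
  obtain ⟨h1, h2, h3⟩ := hinv k hk
  exact ⟨h1, h2, h3, fun hk' => by
    obtain ⟨e1, e2, e3, -⟩ := hstep k hk' h1 h2 h3
    exact ⟨e1, e2, e3⟩⟩

/-- Facts about complete executions. -/
structure RunFacts (f : EuclideanSpace ℝ (Fin n) → ℝ) (x₀ : EuclideanSpace ℝ (Fin n))
    (ν η θ G : ℝ) (x : ℕ → EuclideanSpace ℝ (Fin n)) (γ : ℕ → ℝ) : Prop where
  mem : ∀ k, x k ∈ levelSet f x₀
  one_le : ∀ k, 1 ≤ γ k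
  le_bound : ∀ k, γ k ≤ G
  anti : Antitone fun k => f (x k)
  mono : Monotone γ
  lt : ∀ k, gradient f (x k) ≠ 0 → f (x (k + 1)) < f (x k)
  step : ∀ k, gradient f (x k) ≠ 0 → NewtonCGStep f ν η θ (x k) (γ k) (x (k + 1)) (γ (k + 1))

theorem IsRun.facts (S : StandingAssumptions f x₀ ν Hf Ug UH fLow)
    (hν : 0 < ν) (hη₀ : 0 < η) (hθ₀ : 0 < θ) (hθ₁ : θ < 1) (hγ₀ : 1 ≤ γ₀)
    (h : IsRun f ν η θ γ₀ x₀ x γ) : RunFacts f x₀ ν η θ (max γ₀ (2 * Hf)) x γ where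
  mem k := ((h k).invariants S hν hη₀ hθ₀ hθ₁ hγ₀ k le_rfl).1
  one_le k := ((h k).invariants S hν hη₀ hθ₀ hθ₁ hγ₀ k le_rfl).2.1
  le_bound k := ((h k).invariants S hν hη₀ hθ₀ hθ₁ hγ₀ k le_rfl).2.2.1
  anti := antitone_nat_of_succ_le fun k =>
    (((h (k + 1)).invariants S hν hη₀ hθ₀ hθ₁ hγ₀ k (by omega)).2.2.2 (by omega)).1
  mono := monotone_nat_of_le_succ fun k =>
    (((h (k + 1)).invariants S hν hη₀ hθ₀ hθ₁ hγ₀ k (by omega)).2.2.2 (by omega)).2.1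
  lt k := (((h (k + 1)).invariants S hν hη₀ hθ₀ hθ₁ hγ₀ k (by omega)).2.2.2 (by omega)).2.2
  step k := ((h (k + 1)).2.2 k (by omega)).1

/-- The relative length below which a damped Newton step counts as short in dimension `n`. -/
noncomputable def shortness (n : ℕ) : ℝ := 1 / (1000 * ((n + 1) * 8 ^ (n + 1)))

theorem shortness_pos (n : ℕ) : 0 < shortness n := by
  unfold shortness
  positivity

theorem shortness_mul (n : ℕ) : 1000 * shortness n * ((n + 1) * 8 ^ (n + 1)) = 1 := by
  unfold shortness
  field_simp

/-- With `ε = Γ δ^(1+ν)` and `s = 1/(1+ν)`, the left side is at most `4 ε^(2s) ‖g‖^(2-2s)`. Because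
`ν ≤ 1` gives `2s ≥ 1`, the excess power of `ε` may be traded for one of `‖g‖`. -/
theorem damping_le (hν : 0 < ν) (hν₁ : ν ≤ 1) {c Γ δ : ℝ} (hc : 0 ≤ c) (hΓ : 0 < Γ) (hδ : 0 < δ)
    (hcΓ : c ≤ 2 * Γ) {g : EuclideanSpace ℝ (Fin n)} (hg : Γ * δ ^ (1 + ν) ≤ ‖g‖) :
    (damping ν c g * δ) ^ 2 ≤ 4 * (Γ * δ ^ (1 + ν) * ‖g‖) := by
  set ε := Γ * δ ^ (1 + ν) with hε
  have hε0 : 0 < ε := by positivity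
  have hgp : 0 < ‖g‖ := hε0.trans_le hg
  set s := 1 / (1 + ν) with hs
  have hs1 : s * (1 + ν) = 1 := one_div_mul_cancel (by linarith)
  have hs0 : 0 < s := by positivity
  have h1 : damping ν c g * δ ≤ (2 * ε * ‖g‖ ^ ν) ^ s := by
    have e1 : δ = (δ ^ (1 + ν)) ^ s := by
      rw [← Real.rpow_mul hδ.le, mul_comm, hs1, Real.rpow_one]
    calc damping ν c g * δ ≤ (2 * Γ * ‖g‖ ^ ν) ^ s * (δ ^ (1 + ν)) ^ s := by
          rw [← e1]
          unfold damping
          gcongr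
      _ = (2 * ε * ‖g‖ ^ ν) ^ s := by
          rw [← Real.mul_rpow (by positivity) (by positivity), hε]
          ring_nf
  have h2 : ((2 * ε * ‖g‖ ^ ν) ^ s) ^ 2 = 2 ^ (2 * s) * (ε ^ (2 * s) * ‖g‖ ^ (1 - (2 * s - 1))) := by
    rw [← Real.rpow_natCast, ← Real.rpow_mul (by positivity), Real.mul_rpow (by positivity)
      (by positivity), Real.mul_rpow (by positivity) (by positivity), ← Real.rpow_mul hgp.le]
    have e1 : s * ((2 : ℕ) : ℝ) = 2 * s := by push_cast; ring
    have e2 : ν * (2 * s) = 1 - (2 * s - 1) := by linarith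
    rw [e1, e2, mul_assoc]
  have hs2 : 0 ≤ 2 * s - 1 := by
    rw [hs, sub_nonneg, mul_one_div, one_le_div (by linarith)]
    linarith
  have hsle : s ≤ 1 := by nlinarith
  have h3 : (2 : ℝ) ^ (2 * s) ≤ 4 := by
    calc (2 : ℝ) ^ (2 * s) ≤ 2 ^ (2 : ℝ) :=
          Real.rpow_le_rpow_of_exponent_le (by norm_num) (by linarith)
      _ = 4 := by norm_num
  have h4 : ε ^ (2 * s) * ‖g‖ ^ (1 - (2 * s - 1)) ≤ ε * ‖g‖ := by
    calc ε ^ (2 * s) * ‖g‖ ^ (1 - (2 * s - 1))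
        = ε * ε ^ (2 * s - 1) * ‖g‖ ^ (1 - (2 * s - 1)) := by
          congr 1
          rw [← Real.rpow_one_add' hε0.le (by linarith)]
          ring_nf
      _ ≤ ε * ‖g‖ ^ (2 * s - 1) * ‖g‖ ^ (1 - (2 * s - 1)) := by gcongr
      _ = ε * ‖g‖ := by
          rw [mul_assoc, ← Real.rpow_add hgp]
          ring_nf
          rw [Real.rpow_one]
  have h5 : 0 ≤ damping ν c g * δ := by
    unfold damping
    positivity
  calc (damping ν c g * δ) ^ 2 ≤ ((2 * ε * ‖g‖ ^ ν) ^ s) ^ 2 := by gcongr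
    _ = _ := h2
    _ ≤ 4 * (ε * ‖g‖) := by gcongr

theorem damping_le_two_mul (hν : 0 < ν) {c c' : ℝ} (hc : 0 ≤ c) (hc' : 0 ≤ c') (h : c' ≤ 2 * c)
    {g g' : EuclideanSpace ℝ (Fin n)} (hg : ‖g'‖ ≤ ‖g‖) :
    damping ν c' g' ≤ 2 * damping ν c g := by
  unfold damping
  have hs : 1 / (1 + ν) ≤ 1 := by
    rw [div_le_one (by linarith)]
    linarith
  calc (c' * ‖g'‖ ^ ν) ^ (1 / (1 + ν)) ≤ (2 * (c * ‖g‖ ^ ν)) ^ (1 / (1 + ν)) := by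
        rw [← mul_assoc]
        gcongr
    _ = 2 ^ (1 / (1 + ν)) * (c * ‖g‖ ^ ν) ^ (1 / (1 + ν)) :=
        Real.mul_rpow (by norm_num) (by positivity)
    _ ≤ 2 ^ (1 : ℝ) * (c * ‖g‖ ^ ν) ^ (1 / (1 + ν)) := by
        gcongr
        norm_num
    _ = _ := by rw [Real.rpow_one]

/-- In a window of iterations with large gradients, the objective decreases substantially unless
the estimate of the Hölder constant doubles. -/
theorem RunFacts.window_decrease {G : ℝ} (R : RunFacts f x₀ ν η θ G x γ)
    (S : StandingAssumptions f x₀ ν Hf Ug UH fLow)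
    (hν : 0 < ν) (hν₁ : ν ≤ 1) (hη₀ : 0 < η) (hη₁ : η < 1) (hθ₀ : 0 < θ) (hθ₁ : θ < 1)
    {k₀ L : ℕ} {δ : ℝ} (hδ₀ : 0 < δ) (hδ₁ : δ ≤ 1)
    (hgrad : ∀ k ≤ k₀ + (2 * (n + 1) + L), γ k₀ * δ ^ (1 + ν) < ‖gradient f (x k)‖)
    (hγ : γ (k₀ + (2 * (n + 1) + L)) ≤ 2 * γ k₀)
    (hL : Hf ≤ γ k₀ * 2 ^ ((L : ℝ) * (ν / 2))) :
    decreaseConst ν η θ (shortness n) * (γ k₀ * δ ^ (2 + ν)) ≤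
      f (x k₀) - f (x (k₀ + (2 * (n + 1) + L))) := by
  by_contra! hcon
  set M := 2 * (n + 1) + L with hM
  set Γ := γ k₀ with hΓ
  set ρ := shortness n with hρdef
  have hρ : 0 < ρ := shortness_pos n
  have hρmul := shortness_mul n
  rw [← hρdef] at hρmul
  have hΓ1 : 1 ≤ Γ := R.one_le k₀
  have hΓ0 : 0 < Γ := by linarith
  set ε := Γ * δ ^ (1 + ν) with hε
  have hε0 : 0 < ε := by positivity
  set g := fun i => gradient f (x (k₀ + i)) with hgdef
  set d := fun i => x (k₀ + (i + 1)) - x (k₀ + i) with hddef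
  set e := fun i => damping ν (γ (k₀ + i)) (g i) with hedef
  have hge : ∀ i ≤ M, ε < ‖g i‖ := fun i hi => hgrad (k₀ + i) (by omega)
  have hg0 : ∀ i ≤ M, g i ≠ 0 := fun i hi => norm_pos_iff.1 (hε0.trans (hge i hi))
  have hγlow : ∀ i, Γ ≤ γ (k₀ + i) := fun i => R.mono (by omega)
  have hγup : ∀ i ≤ M, γ (k₀ + i) ≤ 2 * Γ := fun i hi => (R.mono (by omega)).trans hγ
  -- Function values are monotone, so a single substantial decrease would already give the claim for
  -- the whole window; hence every step in it is short.
  have hshort : ∀ i < M, ‖d i‖ ≤ ρ * δ ∧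
      ‖g (i + 1) + (2 * e i) • d i‖ ≤ 1 / 4 * e i * ‖d i‖ + 2 * Γ * ‖d i‖ ^ (1 + ν) ∧
      ‖g (i + 1) - g i - hess f (x (k₀ + i)) (d i)‖ ≤ 2 * Γ * ‖d i‖ ^ (1 + ν) := by
    intro i hi
    refine (S.step_dichotomy hν hν₁ hη₀ hη₁ hθ₀ hθ₁ (R.mem (k₀ + i)) (hg0 i hi.le)
      (R.step (k₀ + i) (hg0 i hi.le)) hΓ1 hδ₀ hδ₁ hρ (hγlow i) (hγup (i + 1) hi)
      (hge i hi.le).le).resolve_left ?_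
    have h1 := R.anti (show k₀ ≤ k₀ + i by omega)
    have h2 := R.anti (show k₀ + i + 1 ≤ k₀ + M by omega)
    simp only at h1 h2
    rw [not_le]
    linarith
  have hpow1 : (1 : ℝ) ≤ 8 ^ (n + 1) := one_le_pow₀ (by norm_num)
  have hn0 : (0 : ℝ) ≤ n := Nat.cast_nonneg n
  have hρn : 2 * ((n : ℝ) + 1) * ρ ≤ 1 := by
    have h1 : ((n : ℝ) + 1) * 1 ≤ ((n : ℝ) + 1) * 8 ^ (n + 1) := by gcongr
    have h2 : ρ * ((n : ℝ) + 1) ≤ ρ * (((n : ℝ) + 1) * 8 ^ (n + 1)) := by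
      gcongr
      linarith
    have h3 : 0 ≤ ρ * ((n : ℝ) + 1) := by positivity
    linarith
  have hρ1 : ρ ≤ 1 := by nlinarith
  have hρ12 : ρ ≤ 1 / 16 := by
    have h1 : (8 : ℝ) ≤ ((n : ℝ) + 1) * 8 ^ (n + 1) := by
      have : (1 : ℝ) ≤ 8 ^ n := one_le_pow₀ (by norm_num)
      rw [pow_succ]
      nlinarith
    nlinarith
  have hrem : ∀ i < M, 2 * Γ * ‖d i‖ ^ (1 + ν) ≤ 2 * ρ * ε := by
    intro i hi
    have h1 : ‖d i‖ ^ (1 + ν) ≤ ρ * δ ^ (1 + ν) := by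
      calc ‖d i‖ ^ (1 + ν) ≤ (ρ * δ) ^ (1 + ν) := by
            gcongr
            exact (hshort i hi).1
        _ = ρ ^ (1 + ν) * δ ^ (1 + ν) := Real.mul_rpow hρ.le hδ₀.le
        _ ≤ ρ * δ ^ (1 + ν) := by
            gcongr
            simpa using Real.rpow_le_rpow_of_exponent_ge hρ hρ1 (show 1 ≤ 1 + ν by linarith)
    calc _ ≤ 2 * Γ * (ρ * δ ^ (1 + ν)) := by gcongr
      _ = _ := by rw [hε]; ring
  have hepos : ∀ i ≤ M, 0 < e i := fun i hi =>
    damping_pos (by linarith [R.one_le (k₀ + i)]) (hg0 i hi)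
  have hed : ∀ i < M, (e i * ‖d i‖) ^ 2 ≤ 4 * ρ ^ 2 * (ε * ‖g i‖) := by
    intro i hi
    have h1 := damping_le hν hν₁ (by linarith [R.one_le (k₀ + i)]) hΓ0 hδ₀ (hγup i hi.le)
      (hge i hi.le).le
    have h2 := hepos i hi.le
    calc (e i * ‖d i‖) ^ 2 ≤ (e i * (ρ * δ)) ^ 2 := by
          gcongr
          exact (hshort i hi).1
      _ = ρ ^ 2 * (e i * δ) ^ 2 := by ring
      _ ≤ ρ ^ 2 * (4 * (ε * ‖g i‖)) := by gcongr
      _ = _ := by ring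
  have hres : ∀ i < M, ‖g (i + 1) + (2 * e i) • d i‖ ≤ 1 / 4 * e i * ‖d i‖ + 2 * ρ * ε :=
    fun i hi => (hshort i hi).2.1.trans (by linarith [hrem i hi])
  have hhalf : ∀ i < M, 2 * ‖g (i + 1)‖ ≤ ‖g i‖ := by
    intro i hi
    have h1 := (short_step_bounds (hepos i hi.le) hρ.le hρ12 (hge (i + 1) hi).le (hres i hi)).1
    have h2 := hed i hi
    have h3 := (hge i hi.le).le
    have h4 : e i * ‖d i‖ ≤ 2 * ρ * ‖g i‖ := by
      have := hepos i hi.le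
      refine (pow_le_pow_iff_left₀ (by positivity) (by positivity) two_ne_zero).1 ?_
      calc _ ≤ 4 * ρ ^ 2 * (ε * ‖g i‖) := h2
        _ ≤ 4 * ρ ^ 2 * (‖g i‖ * ‖g i‖) := by gcongr
        _ = _ := by ring
    have h5 : ρ * ‖g i‖ ≤ 1 / 16 * ‖g i‖ := by gcongr
    have := norm_nonneg (g i)
    linarith
  -- Read backwards from the end of the window, the halving of gradients becomes doubling.
  have hlarge : ∀ q ≤ M, 2 ^ q * ε ≤ ‖g (M - q)‖ := by
    intro q
    induction q with
    | zero => intro _; simpa using (hge M le_rfl).le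
    | succ q ih =>
      intro hq
      have h1 := ih (by omega)
      have h2 := hhalf (M - (q + 1)) (by omega)
      rw [show M - (q + 1) + 1 = M - q by omega] at h2
      rw [pow_succ]
      linarith
  have hanti : ∀ k l, k ≤ l → l ≤ M → ‖g l‖ ≤ ‖g k‖ := by
    intro k l hkl hl
    induction l, hkl using Nat.le_induction with
    | base => exact le_rfl
    | succ l hkl ih =>
      have e1 := hhalf l (by omega)
      have e2 := norm_nonneg (g (l + 1))
      have e3 := ih (by omega)
      linarith
  -- The `L` later iterations raise these gradients by `2 ^ L`, which amounts to replacing `δ` by `δ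
  -- * 2 ^ (L/(1+ν))` in the damping bound. As `ν/(1+ν) ≥ ν/2`, the choice of `L` compensates for an
  -- estimate far below `Hf`.
  have helarge : ∀ k < 2 * (n + 1), Hf * δ ^ ν ≤ e k := by
    intro k hk
    have h1 : 2 ^ L * ε ≤ ‖g k‖ := by
      have h2 := hlarge L (by omega)
      exact h2.trans (hanti k (M - L) (by omega) (by omega))
    have hs1 : 1 / (1 + ν) * (1 + ν) = 1 := one_div_mul_cancel (by linarith)
    have h3 := mul_rpow_le_damping (ν := ν) (δ := δ * 2 ^ ((L : ℝ) * (1 / (1 + ν)))) hν hΓ0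
      (by positivity) (hγlow k) (g := g k) (by
        refine le_trans (le_of_eq ?_) h1
        rw [Real.mul_rpow hδ₀.le (by positivity), ← Real.rpow_mul (by norm_num), mul_assoc, hs1,
          mul_one, Real.rpow_natCast, hε]
        ring)
    refine le_trans ?_ h3
    rw [Real.mul_rpow hδ₀.le (by positivity), ← Real.rpow_mul (by norm_num)]
    have hs2 : ν / 2 ≤ 1 / (1 + ν) * ν := by
      rw [one_div_mul_eq_div]
      gcongr
      linarith
    calc Hf * δ ^ ν ≤ Γ * 2 ^ ((L : ℝ) * (ν / 2)) * δ ^ ν := by gcongr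
      _ ≤ Γ * 2 ^ ((L : ℝ) * (1 / (1 + ν) * ν)) * δ ^ ν := by
        gcongr
        norm_num
      _ = _ := by ring_nf
  have hdist : ∀ k l, k ≤ l → l ≤ 2 * (n + 1) →
      ‖x (k₀ + l) - x (k₀ + k)‖ ≤ ((l : ℝ) - k) * (ρ * δ) := by
    intro k l hkl hl
    induction l, hkl using Nat.le_induction with
    | base => simp
    | succ l hkl ih =>
      have e1 := ih (by omega)
      have e2 := (hshort l (by omega)).1
      have e3 : x (k₀ + (l + 1)) - x (k₀ + k) = d l + (x (k₀ + l) - x (k₀ + k)) := by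
        simp [hddef]
      rw [e3]
      refine (norm_add_le _ _).trans ?_
      push_cast
      linarith
  have hHess : ∀ k l, k ≤ l → l < 2 * (n + 1) →
      ‖hess f (x (k₀ + k)) - hess f (x (k₀ + l))‖ ≤ e k := by
    intro k l hkl hl
    have hmem : ∀ i, x i ∈ levelNhd f x₀ (max (1.1 : ℝ) (max (1.1 * Ug) UH)) := fun i =>
      ⟨x i, R.mem i, by
        rw [sub_self, norm_zero]
        exact le_max_of_le_left (by norm_num)⟩
    have h1 := S.holder _ (hmem (k₀ + k)) _ (hmem (k₀ + l))
    have h2 : ‖x (k₀ + l) - x (k₀ + k)‖ ≤ δ := by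
      refine (hdist k l hkl hl.le).trans ?_
      have h3 : (l : ℝ) - k ≤ 2 * (n + 1) := by
        have : (l : ℝ) ≤ 2 * (n + 1) := by exact_mod_cast hl.le
        have : (0 : ℝ) ≤ k := Nat.cast_nonneg k
        linarith
      calc _ ≤ 2 * ((n : ℝ) + 1) * (ρ * δ) := by gcongr
        _ = 2 * ((n : ℝ) + 1) * ρ * δ := by ring
        _ ≤ 1 * δ := by gcongr
        _ = δ := one_mul δ
    have h4 := S.one_le_Hf
    rw [norm_sub_rev]
    calc _ ≤ Hf * ‖x (k₀ + l) - x (k₀ + k)‖ ^ ν := h1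
      _ ≤ Hf * δ ^ ν := by gcongr
      _ ≤ e k := helarge k (by omega)
  refine no_long_chain (n := n) hρ ?_ hε0 g d (fun k => hess f (x (k₀ + k))) e
    (fun k => hess_symm S.contDiff _) (fun k hk => hepos k (by omega))
    (fun k hk => (hge k (by omega)).le) (fun k hk => hres k (by omega))
    (fun k hk => (hshort k (by omega)).2.2.trans (hrem k (by omega)))
    (fun k hk => hed k (by omega)) (fun k l hkl hl => ?_) hHess
  · have : 0 ≤ ρ * ((n + 1) * 8 ^ (n + 1)) := by positivity
    linarith
  · exact damping_le_two_mul hν (by linarith [R.one_le (k₀ + k)]) (by linarith [R.one_le (k₀ + l)])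
      ((hγup l (by omega)).trans (by linarith [hγlow k])) (hanti k l hkl (by omega))

end Window

/-! ### Summing the windows. -/

section Count

variable {n : ℕ} {f : EuclideanSpace ℝ (Fin n) → ℝ} {x₀ : EuclideanSpace ℝ (Fin n)}
  {ν η θ γ₀ Hf Ug UH fLow : ℝ} {x : ℕ → EuclideanSpace ℝ (Fin n)} {γ : ℕ → ℝ}

theorem decreaseConst_pos {ρ : ℝ} (hη₀ : 0 < η) (hη₁ : η < 1) (hθ₀ : 0 < θ) (hρ : 0 < ρ) :
    0 < decreaseConst ν η θ ρ := by
  have : 0 < (1 - η) / 2 := by linarith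
  unfold decreaseConst
  positivity

/-- The factor by which the window length exceeds `(Hf / γ)^(1/(1+ν))`. -/
noncomputable def windowConst (ν γ₀ : ℝ) (n : ℕ) : ℝ := (2 * n + 3) * (2 * γ₀) + 8 / ν

theorem windowConst_pos (hν : 0 < ν) (hγ₀ : 1 ≤ γ₀) : 0 < windowConst ν γ₀ n := by
  unfold windowConst
  positivity

theorem logb_two_le (hν : 0 < ν) (hν₁ : ν ≤ 1) {X : ℝ} (hX : 0 ≤ X) :
    Real.logb 2 X ≤ 4 * X ^ (1 / (1 + ν)) := by
  have h1 := Real.log_le_rpow_div hX (ε := 1 / (1 + ν)) (by positivity)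
  have h2 : X ^ (1 / (1 + ν)) / (1 / (1 + ν)) ≤ 2 * X ^ (1 / (1 + ν)) := by
    rw [div_div_eq_mul_div, div_one, mul_comm]
    gcongr
    linarith
  have h3 := Real.log_two_gt_d9
  have h4 : 0 ≤ X ^ (1 / (1 + ν)) := by positivity
  rw [Real.logb, div_le_iff₀ (by linarith)]
  nlinarith

/-- A logarithmic `L` would suffice; it is replaced by a multiple of the power `(Hf/Γ)^(1/(1+ν))`,
which cancels exactly against the decrease in a window. The constant part of the length fits the
same form because `Hf/Γ ≥ 1/(2 γ₀)`. -/
theorem exists_window (hν : 0 < ν) (hν₁ : ν ≤ 1) (hγ₀ : 1 ≤ γ₀) {Γ : ℝ} (hΓ : 1 ≤ Γ)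
    (hHf : 1 ≤ Hf) (hΓle : Γ ≤ max γ₀ (2 * Hf)) (n : ℕ) :
    ∃ L : ℕ, Hf ≤ Γ * 2 ^ ((L : ℝ) * (ν / 2)) ∧
      ((2 * (n + 1) + L : ℕ) : ℝ) ≤ windowConst ν γ₀ n * (Hf / Γ) ^ (1 / (1 + ν)) := by
  have hΓ0 : 0 < Γ := by linarith
  have hX : 0 < Hf / Γ := by positivity
  set X := Hf / Γ with hXdef
  set s := 1 / (1 + ν) with hs
  have hs0 : 0 < s := by positivity
  have hs1 : s ≤ 1 := by
    rw [hs, div_le_one (by linarith)]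
    linarith
  have hXs : 0 < X ^ s := by positivity
  refine ⟨⌈8 / ν * X ^ s⌉₊, ?_, ?_⟩
  · have h1 := Nat.le_ceil (8 / ν * X ^ s)
    have h2 : Real.logb 2 X ≤ (⌈8 / ν * X ^ s⌉₊ : ℝ) * (ν / 2) := by
      refine (logb_two_le hν hν₁ hX.le).trans ?_
      calc 4 * X ^ s = 8 / ν * X ^ s * (ν / 2) := by field_simp; norm_num
        _ ≤ _ := by gcongr
    have h3 : X ≤ 2 ^ ((⌈8 / ν * X ^ s⌉₊ : ℝ) * (ν / 2)) := by
      calc X = 2 ^ Real.logb 2 X := (Real.rpow_logb (by norm_num) (by norm_num) hX).symm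
        _ ≤ _ := Real.rpow_le_rpow_of_exponent_le (by norm_num) h2
    calc Hf = Γ * X := by rw [hXdef]; field_simp
      _ ≤ _ := by gcongr
  · have h1 := Nat.ceil_lt_add_one (show 0 ≤ 8 / ν * X ^ s by positivity)
    have h2 : 1 ≤ 2 * γ₀ * X ^ s := by
      have h3 : 1 / (2 * γ₀) ≤ X := by
        rw [hXdef, div_le_div_iff₀ (by positivity) hΓ0]
        have : max γ₀ (2 * Hf) ≤ Hf * (2 * γ₀) := max_le (by nlinarith) (by nlinarith)
        linarith
      have h4 : 1 / (2 * γ₀) ≤ X ^ s := by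
        calc 1 / (2 * γ₀) = (1 / (2 * γ₀)) ^ (1 : ℝ) := (Real.rpow_one _).symm
          _ ≤ (1 / (2 * γ₀)) ^ s := by
            apply Real.rpow_le_rpow_of_exponent_ge (by positivity) _ hs1
            rw [div_le_one (by positivity)]
            linarith
          _ ≤ X ^ s := by gcongr
      rw [div_le_iff₀ (by positivity)] at h4
      linarith
    have h5 : ((2 * (n : ℝ)) + 3) * 1 ≤ (2 * n + 3) * (2 * γ₀ * X ^ s) := by gcongr
    push_cast
    unfold windowConst
    linarith

/-- The number of iterations after the `m`-th one with gradient norm above `ε`. -/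
theorem RunFacts.count_le (R : RunFacts f x₀ ν η θ (max γ₀ (2 * Hf)) x γ)
    (S : StandingAssumptions f x₀ ν Hf Ug UH fLow)
    (hν : 0 < ν) (hν₁ : ν ≤ 1) (hη₀ : 0 < η) (hη₁ : η < 1) (hθ₀ : 0 < θ) (hθ₁ : θ < 1)
    (hγ₀ : 1 ≤ γ₀) {ε fInf : ℝ} (hε₀ : 0 < ε) (hε₁ : ε ≤ 1) (hfInf : ∀ k, fInf ≤ f (x k))
    {N : ℕ} (hN : ∀ k < N, ε < ‖gradient f (x k)‖) (m : ℕ) (hm : m ≤ N) :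
    (N : ℝ) - m ≤ windowConst ν γ₀ n / decreaseConst ν η θ (shortness n) *
        Hf ^ (1 / (1 + ν)) * ε ^ (-((2 + ν) / (1 + ν))) * (f (x m) - fInf) +
      windowConst ν γ₀ n * Hf * (Real.logb 2 (max γ₀ (2 * Hf)) - Real.logb 2 (γ m) + 1) := by
  set W := windowConst ν γ₀ n with hW
  set A := decreaseConst ν η θ (shortness n) with hA
  set s := 1 / (1 + ν) with hs
  set p := (2 + ν) / (1 + ν) with hp
  have hWpos : 0 < W := windowConst_pos hν hγ₀
  have hApos : 0 < A := decreaseConst_pos hη₀ hη₁ hθ₀ (shortness_pos n)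
  have hHf := S.one_le_Hf
  have hs0 : 0 < s := by positivity
  have hs1 : s ≤ 1 := by
    rw [hs, div_le_one (by linarith)]
    linarith
  set B := W / A * Hf ^ s * ε ^ (-p) with hB
  have hBpos : 0 < B := by positivity
  induction hq : N - m using Nat.strong_induction_on generalizing m with
  | _ q ih =>
  have hΓ1 := R.one_le m
  have hΓ0 : 0 < γ m := by linarith
  obtain ⟨L, hL, hM⟩ := exists_window hν hν₁ hγ₀ hΓ1 hHf (R.le_bound m) n
  set M := 2 * (n + 1) + L with hMdef
  have hMD : (M : ℝ) ≤ W * Hf := by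
    refine hM.trans ?_
    gcongr
    calc (Hf / γ m) ^ s ≤ Hf ^ s := by
          gcongr
          exact div_le_self (by linarith) hΓ1
      _ ≤ Hf ^ (1 : ℝ) := Real.rpow_le_rpow_of_exponent_le hHf hs1
      _ = Hf := Real.rpow_one _
  have hD : 0 < W * Hf := by positivity
  have hf0 : 0 ≤ f (x m) - fInf := by linarith [hfInf m]
  have hlog : Real.logb 2 (γ m) ≤ Real.logb 2 (max γ₀ (2 * Hf)) :=
    Real.logb_le_logb_of_le (by norm_num) hΓ0 (R.le_bound m)
  rcases le_or_gt N (m + M) with hcase | hcase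
  -- The last, possibly incomplete window is paid for by the `+ 1` next to the logarithms.
  · have h1 : (N : ℝ) ≤ m + M := by exact_mod_cast hcase
    have h2 : 0 ≤ B * (f (x m) - fInf) := by positivity
    have h3 : 0 ≤ W * Hf * (Real.logb 2 (max γ₀ (2 * Hf)) - Real.logb 2 (γ m)) :=
      mul_nonneg hD.le (by linarith)
    linarith
  have hih := ih (N - (m + M)) (by omega) (m + M) (by omega) rfl
  push_cast at hih
  have hfm : f (x (m + M)) ≤ f (x m) := R.anti (by omega)
  have hγm : γ m ≤ γ (m + M) := R.mono (by omega)
  rcases le_or_gt (γ (m + M)) (2 * γ m) with hγ | hγ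
  -- Chosen so that the gradient threshold `γ m * δ ^ (1 + ν)` of the window is exactly `ε`.
  · set δ := (ε / γ m) ^ s with hδ
    have hq0 : 0 < ε / γ m := by positivity
    have hδ1 : γ m * δ ^ (1 + ν) = ε := by
      rw [hδ, ← Real.rpow_mul hq0.le, one_div_mul_cancel (by linarith), Real.rpow_one]
      field_simp
    have hwin := R.window_decrease S hν hν₁ hη₀ hη₁ hθ₀ hθ₁ (k₀ := m) (L := L) (δ := δ)
      (by positivity) (Real.rpow_le_one hq0.le (by
        rw [div_le_one hΓ0]
        linarith) hs0.le)
      (fun k hk => by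
        rw [hδ1]
        exact hN k (by omega)) hγ hL
    rw [← hMdef, ← hA] at hwin
    have hδ2 : γ m * δ ^ (2 + ν) = ε ^ p / (γ m) ^ s := by
      rw [hδ, ← Real.rpow_mul hq0.le, show s * (2 + ν) = p by rw [hs, hp]; ring,
        Real.div_rpow hε₀.le hΓ0.le, show p = 1 + s by rw [hs, hp]; field_simp; ring,
        Real.rpow_add hΓ0 1 s, Real.rpow_one]
      field_simp
    -- The powers of `γ m` in length and decrease cancel, so the price per unit of decrease is the
    -- same for all windows.
    have hkey : W * (Hf / γ m) ^ s = B * (A * (γ m * δ ^ (2 + ν))) := by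
      rw [hδ2, hB, Real.div_rpow (by linarith) hΓ0.le, Real.rpow_neg hε₀.le]
      field_simp
    have h1 : (M : ℝ) ≤ B * (f (x m) - f (x (m + M))) := by
      rw [hkey] at hM
      exact hM.trans (by gcongr)
    have h2 : W * Hf * Real.logb 2 (γ m) ≤ W * Hf * Real.logb 2 (γ (m + M)) := by
      gcongr
      norm_num
    linarith
  -- A doubling of the estimate lowers the logarithmic potential by at least one, which pays for at
  -- most `W * Hf` iterations.
  · have h1 : Real.logb 2 (γ m) + 1 ≤ Real.logb 2 (γ (m + M)) := by
      have e1 : Real.logb 2 (2 * γ m) = Real.logb 2 (γ m) + 1 := by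
        rw [Real.logb_mul (by norm_num) hΓ0.ne', Real.logb_self_eq_one (by norm_num), add_comm]
      rw [← e1]
      exact Real.logb_le_logb_of_le (by norm_num) (by positivity) hγ.le
    have h2 : W * Hf * (Real.logb 2 (γ m) + 1) ≤ W * Hf * Real.logb 2 (γ (m + M)) := by gcongr
    have h3 : B * f (x (m + M)) ≤ B * f (x m) := by gcongr
    linarith

theorem nonstationary_bound {ε b : ℝ}
    (h : ∀ N : ℕ, (∀ k < N, ε < ‖gradient f (x k)‖) → (N : ℝ) ≤ b) :
    (nonstationary f x ε).Finite ∧ ((nonstationary f x ε).ncard : ℝ) ≤ b := by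
  have hb : 0 ≤ b := by simpa using h 0 (fun k hk => absurd hk (Nat.not_lt_zero k))
  have hsub : nonstationary f x ε ⊆ (Finset.range ⌊b⌋₊ : Set ℕ) := by
    intro k hk
    have h1 := h (k + 1) fun t ht => hk t (by omega)
    have h2 := Nat.le_floor h1
    simp only [Finset.coe_range, Set.mem_Iio]
    omega
  refine ⟨(Finset.finite_toSet _).subset hsub, ?_⟩
  have h1 := Set.ncard_le_ncard hsub (Finset.finite_toSet _)
  rw [Set.ncard_coe_finset, Finset.card_range] at h1
  exact (Nat.cast_le.2 h1).trans (Nat.floor_le hb)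

/-- A constant is dominated by the complexity bound once `ε` is small. -/
theorem le_mul_rpow_of_small (hν : 0 < ν) {D Δ ε : ℝ} (hΔ : 0 < Δ) (hHf : 1 ≤ Hf) (hε₀ : 0 < ε)
    (hε₁ : ε ≤ 1) (hε : ε ≤ Δ / (|D| + 1)) :
    D ≤ Δ * Hf ^ (1 / (1 + ν)) * ε ^ (-((2 + ν) / (1 + ν))) := by
  have hD : 0 < |D| + 1 := by positivity
  rw [le_div_iff₀ hD] at hε
  have h1 : D ≤ Δ * ε ^ (-1 : ℝ) := by
    rw [Real.rpow_neg_one, ← div_eq_mul_inv, le_div_iff₀ hε₀]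
    nlinarith [le_abs_self D]
  have h2 : ε ^ (-1 : ℝ) ≤ ε ^ (-((2 + ν) / (1 + ν))) := by
    apply Real.rpow_le_rpow_of_exponent_ge hε₀ hε₁
    rw [neg_le_neg_iff, one_le_div (by linarith)]
    linarith
  have h3 : 1 ≤ Hf ^ (1 / (1 + ν)) := Real.one_le_rpow hHf (by positivity)
  calc D ≤ Δ * ε ^ (-1 : ℝ) := h1
    _ ≤ Δ * ε ^ (-((2 + ν) / (1 + ν))) := by gcongr
    _ ≤ Δ * Hf ^ (1 / (1 + ν)) * ε ^ (-((2 + ν) / (1 + ν))) := by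
      gcongr
      exact le_mul_of_one_le_right hΔ.le h3

/-- A nonzero initial gradient would yield a strict decrease below `fLow`. This settles the
degenerate zero gap, in which the claimed bound is `0` and nothing can be absorbed. -/
theorem RunFacts.gradient_eq_zero {G : ℝ} (R : RunFacts f x₀ ν η θ G x γ)
    (S : StandingAssumptions f x₀ ν Hf Ug UH fLow) (hx : x 0 = x₀) (h : f x₀ - fLow ≤ 0) :
    gradient f (x 0) = 0 := by
  by_contra hg
  have h1 := R.lt 0 hg
  have h2 := S.lower_bound _ (R.mem 1)
  rw [hx] at h1
  norm_num at h1
  linarith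

theorem StandingAssumptions.gap_nonneg (S : StandingAssumptions f x₀ ν Hf Ug UH fLow) :
    0 ≤ f x₀ - fLow :=
  sub_nonneg.2 (S.lower_bound x₀ (le_refl (f x₀)))

theorem RunFacts.bound_of_gap_nonpos {G : ℝ} (R : RunFacts f x₀ ν η θ G x γ)
    (S : StandingAssumptions f x₀ ν Hf Ug UH fLow) (hx : x 0 = x₀) (h : f x₀ - fLow ≤ 0)
    {ε : ℝ} (hε : 0 < ε) (C D E : ℝ) :
    (nonstationary f x ε).Finite ∧
      ((nonstationary f x ε).ncard : ℝ) ≤ C * (f x₀ - fLow) * D * E := by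
  rw [le_antisymm h S.gap_nonneg, mul_zero, zero_mul, zero_mul]
  refine nonstationary_bound fun N hN => ?_
  rcases N with _ | N
  · simp
  · have h1 := hN 0 (Nat.succ_pos N)
    rw [R.gradient_eq_zero S hx h, norm_zero] at h1
    linarith

/-- Every finite execution can be continued. -/
theorem exists_continuation (S : StandingAssumptions f x₀ ν Hf Ug UH fLow)
    (hν : 0 < ν) (hη₀ : 0 < η) (hη₁ : η < 1) (hθ₀ : 0 < θ) (hθ₁ : θ < 1) (hγ₀ : 1 ≤ γ₀)
    {N : ℕ} (h : IsPartialRun f ν η θ γ₀ x₀ N x γ) :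
    ∃ (y : ℕ → EuclideanSpace ℝ (Fin n)) (δ : ℕ → ℝ),
      IsRun f ν η θ γ₀ x₀ y δ ∧ ∀ k ≤ N, y k = x k ∧ δ k = γ k := by
  classical
  let P : EuclideanSpace ℝ (Fin n) × ℝ → EuclideanSpace ℝ (Fin n) × ℝ → Prop := fun z w =>
    (gradient f z.1 ≠ 0 → NewtonCGStep f ν η θ z.1 z.2 w.1 w.2) ∧
      (gradient f z.1 = 0 → w.1 = z.1 ∧ w.2 = z.2)
  have hP : ∀ z : EuclideanSpace ℝ (Fin n) × ℝ, ∃ w, z.1 ∈ levelSet f x₀ → 1 ≤ z.2 → P z w := by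
    intro z
    by_cases hz : z.1 ∈ levelSet f x₀ ∧ 1 ≤ z.2
    · by_cases hg : gradient f z.1 = 0
      · exact ⟨z, fun _ _ => ⟨fun h => absurd hg h, fun _ => ⟨rfl, rfl⟩⟩⟩
      · obtain ⟨x', γ', hs⟩ := S.exists_step hν hη₁ hθ₀ hθ₁ hz.1 hz.2 hg
        exact ⟨(x', γ'), fun _ _ => ⟨fun _ => hs, fun h => absurd h hg⟩⟩
    · exact ⟨z, fun h1 h2 => absurd ⟨h1, h2⟩ hz⟩
  choose next hnext using hP
  -- The given iterates are copied up to index `N`; only then does the chosen successor take over.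
  let w : ℕ → EuclideanSpace ℝ (Fin n) × ℝ := fun k =>
    Nat.rec (x 0, γ 0) (fun k z => if k + 1 ≤ N then (x (k + 1), γ (k + 1)) else next z) k
  have hw1 : ∀ k ≤ N, w k = (x k, γ k) := by
    intro k hk
    rcases k with _ | k
    · rfl
    · exact if_pos hk
  have hw2 : ∀ k, N ≤ k → w (k + 1) = next (w k) := fun k hk => if_neg (by omega)
  refine ⟨fun k => (w k).1, fun k => (w k).2, ?_, fun k hk => by simp [hw1 k hk]⟩
  intro K
  induction K with
  | zero => exact ⟨by simp [hw1 0, h.1], by simp [hw1 0, h.2.1], fun k hk => by omega⟩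
  | succ K ih =>
    refine ⟨ih.1, ih.2.1, fun k hk => ?_⟩
    rcases Nat.lt_succ_iff_lt_or_eq.1 hk with hk | rfl
    · exact ih.2.2 k hk
    · rcases lt_or_ge k N with hkN | hkN
      · have := h.2.2 k hkN
        simpa [hw1 k hkN.le, hw1 (k + 1) hkN] using this
      · obtain ⟨h1, h2, -, -⟩ := ih.invariants S hν hη₀ hθ₀ hθ₁ hγ₀ k le_rfl
        have := hnext (w k) h1 h2
        simp only [hw2 k hkN]
        exact this

end Count

/-! ### The complexity theorem. -/

theorem theorem1 (ν η θ γ₀ : ℝ) (hν₀ : 0 < ν) (hν₁ : ν ≤ 1) (hη₀ : 0 < η) (hη₁ : η < 1)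
    (hθ₀ : 0 < θ) (hθ₁ : θ < 1) (hγ₀ : 1 ≤ γ₀) :
    -- the method is well defined: every finite execution can be continued
    (∀ (n : ℕ) (f : EuclideanSpace ℝ (Fin n) → ℝ) (x₀ : EuclideanSpace ℝ (Fin n))
      (Hf Ug UH fLow : ℝ), StandingAssumptions f x₀ ν Hf Ug UH fLow →
      ∀ (N : ℕ) (x : ℕ → EuclideanSpace ℝ (Fin n)) (γ : ℕ → ℝ),
        IsPartialRun f ν η θ γ₀ x₀ N x γ →
        ∃ (y : ℕ → EuclideanSpace ℝ (Fin n)) (δ : ℕ → ℝ),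
          IsRun f ν η θ γ₀ x₀ y δ ∧ ∀ k ≤ N, y k = x k ∧ δ k = γ k) ∧
    -- a constant that depends on `ν, η, θ, γ₀` only, `ε` small for the given sequence
    (∃ C : ℝ, 0 < C ∧
      ∀ (n : ℕ) (f : EuclideanSpace ℝ (Fin n) → ℝ) (x₀ : EuclideanSpace ℝ (Fin n))
        (Hf Ug UH fLow : ℝ), StandingAssumptions f x₀ ν Hf Ug UH fLow →
        ∀ (x : ℕ → EuclideanSpace ℝ (Fin n)) (γ : ℕ → ℝ), IsRun f ν η θ γ₀ x₀ x γ →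
          ∃ ε₀ : ℝ, 0 < ε₀ ∧ ∀ ε : ℝ, 0 < ε → ε ≤ ε₀ →
            (nonstationary f x ε).Finite ∧
            ((nonstationary f x ε).ncard : ℝ) ≤
              C * (f x₀ - fLow) * Hf ^ (1 / (1 + ν)) * ε ^ (-((2 + ν) / (1 + ν)))) ∧
    -- uniformly over all objectives of a fixed dimension with the same problem constants
    (∀ n : ℕ, ∃ C : ℝ, 0 < C ∧ ∀ Hf Ug UH Δ : ℝ, ∃ ε₀ : ℝ, 0 < ε₀ ∧
      ∀ (f : EuclideanSpace ℝ (Fin n) → ℝ) (x₀ : EuclideanSpace ℝ (Fin n)) (fLow : ℝ),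
        StandingAssumptions f x₀ ν Hf Ug UH fLow → f x₀ - fLow = Δ →
        ∀ (x : ℕ → EuclideanSpace ℝ (Fin n)) (γ : ℕ → ℝ), IsRun f ν η θ γ₀ x₀ x γ →
          ∀ ε : ℝ, 0 < ε → ε ≤ ε₀ →
            (nonstationary f x ε).Finite ∧
            ((nonstationary f x ε).ncard : ℝ) ≤
              C * Δ * Hf ^ (1 / (1 + ν)) * ε ^ (-((2 + ν) / (1 + ν)))) := by
  refine ⟨fun n f x₀ Hf Ug UH fLow S N x γ h =>
    exists_continuation S hν₀ hη₀ hη₁ hθ₀ hθ₁ hγ₀ h, ?_, ?_⟩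
  -- One unit for the tail of the run, one for all contributions that do not depend on `ε`.
  · refine ⟨2, two_pos, fun n f x₀ Hf Ug UH fLow S x γ h => ?_⟩
    have R := h.facts S hν₀ hη₀ hθ₀ hθ₁ hγ₀
    rcases le_or_gt (f x₀ - fLow) 0 with hΔ | hΔ
    · exact ⟨1, one_pos, fun ε hε _ => R.bound_of_gap_nonpos S (h 0).1 hΔ hε _ _ _⟩
    set Q := windowConst ν γ₀ n / decreaseConst ν η θ (shortness n) with hQ
    have hQpos : 0 < Q := div_pos (windowConst_pos hν₀ hγ₀)
      (decreaseConst_pos hη₀ hη₁ hθ₀ (shortness_pos n))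
    have hbdd : BddBelow (Set.range fun k => f (x k)) :=
      ⟨fLow, by rintro _ ⟨k, rfl⟩; exact S.lower_bound _ (R.mem k)⟩
    -- The lower bound used here is the infimum along the sequence, not `fLow`, so the remaining
    -- decrease after `m` can be made smaller than the gap divided by the dimension-dependent `Q`.
    obtain ⟨m, hm⟩ := exists_lt_of_ciInf_lt
      (lt_add_of_pos_right (⨅ k, f (x k)) (div_pos hΔ hQpos))
    set D := (m : ℝ) + windowConst ν γ₀ n * Hf *
      (Real.logb 2 (max γ₀ (2 * Hf)) - Real.logb 2 (γ m) + 1) with hD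
    refine ⟨min 1 ((f x₀ - fLow) / (|D| + 1)), by positivity, fun ε hε hεle => ?_⟩
    have hε1 := hεle.trans (min_le_left _ _)
    have hsmall := le_mul_rpow_of_small hν₀ hΔ S.one_le_Hf hε hε1 (hεle.trans (min_le_right _ _))
    have hHf := S.one_le_Hf
    refine nonstationary_bound fun N hN => ?_
    have hbound : (N : ℝ) ≤
        (f x₀ - fLow) * Hf ^ (1 / (1 + ν)) * ε ^ (-((2 + ν) / (1 + ν))) + D := by
      rcases le_total m N with hmN | hmN
      · have hcount := R.count_le S hν₀ hν₁ hη₀ hη₁ hθ₀ hθ₁ hγ₀ hε hε1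
          (fun k => ciInf_le hbdd k) hN m hmN
        have htail : Q * (f (x m) - ⨅ k, f (x k)) ≤ f x₀ - fLow := by
          rw [mul_comm, ← le_div_iff₀ hQpos]
          linarith
        have hscaled : Q * (f (x m) - ⨅ k, f (x k)) *
            (Hf ^ (1 / (1 + ν)) * ε ^ (-((2 + ν) / (1 + ν)))) ≤
            (f x₀ - fLow) * (Hf ^ (1 / (1 + ν)) * ε ^ (-((2 + ν) / (1 + ν)))) := by gcongr
        linarith
      · have hlog : Real.logb 2 (γ m) ≤ Real.logb 2 (max γ₀ (2 * Hf)) :=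
          Real.logb_le_logb_of_le (by norm_num) (by linarith [R.one_le m]) (R.le_bound m)
        have hrest : 0 ≤ windowConst ν γ₀ n * Hf *
            (Real.logb 2 (max γ₀ (2 * Hf)) - Real.logb 2 (γ m) + 1) := by
          have := windowConst_pos (n := n) hν₀ hγ₀
          exact mul_nonneg (by positivity) (by linarith)
        have hNm : (N : ℝ) ≤ m := by exact_mod_cast hmN
        have hmain : 0 ≤ (f x₀ - fLow) * Hf ^ (1 / (1 + ν)) * ε ^ (-((2 + ν) / (1 + ν))) := by
          positivity
        linarith
    linarith
  · intro n
    set Q := windowConst ν γ₀ n / decreaseConst ν η θ (shortness n) with hQ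
    have hQpos : 0 < Q := div_pos (windowConst_pos hν₀ hγ₀)
      (decreaseConst_pos hη₀ hη₁ hθ₀ (shortness_pos n))
    refine ⟨Q + 1, by linarith, fun Hf Ug UH Δ => ?_⟩
    -- Counting starts at `m = 0`, and the nonnegative `logb 2 (γ 0)` is dropped, so this quantity,
    -- and with it the threshold, does not depend on the objective or the run.
    set D := windowConst ν γ₀ n * Hf * (Real.logb 2 (max γ₀ (2 * Hf)) + 1) with hD
    rcases le_or_gt Δ 0 with hΔ | hΔ
    · refine ⟨1, one_pos, fun f x₀ fLow S hgap x γ h ε hε _ => ?_⟩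
      have R := h.facts S hν₀ hη₀ hθ₀ hθ₁ hγ₀
      subst hgap
      exact R.bound_of_gap_nonpos S (h 0).1 hΔ hε _ _ _
    · refine ⟨min 1 (Δ / (|D| + 1)), by positivity, fun f x₀ fLow S hgap x γ h ε hε hεle => ?_⟩
      have R := h.facts S hν₀ hη₀ hθ₀ hθ₁ hγ₀
      have hε1 := hεle.trans (min_le_left _ _)
      have hHf := S.one_le_Hf
      have hsmall := le_mul_rpow_of_small hν₀ hΔ hHf hε hε1 (hεle.trans (min_le_right _ _))
      refine nonstationary_bound fun N hN => ?_
      have hcount := R.count_le S hν₀ hν₁ hη₀ hη₁ hθ₀ hθ₁ hγ₀ hε hε1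
        (fun k => S.lower_bound _ (R.mem k)) hN 0 (Nat.zero_le N)
      rw [(h 0).1, hgap, Nat.cast_zero, sub_zero] at hcount
      have hlog : 0 ≤ Real.logb 2 (γ 0) := Real.logb_nonneg (by norm_num) (R.one_le 0)
      have hWH : 0 ≤ windowConst ν γ₀ n * Hf * Real.logb 2 (γ 0) := by
        have := windowConst_pos (n := n) hν₀ hγ₀
        positivity
      calc (N : ℝ) ≤ Q * Hf ^ (1 / (1 + ν)) * ε ^ (-((2 + ν) / (1 + ν))) * Δ + D := by
            rw [hD]
            linarith
        _ ≤ Q * Hf ^ (1 / (1 + ν)) * ε ^ (-((2 + ν) / (1 + ν))) * Δ +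
            Δ * Hf ^ (1 / (1 + ν)) * ε ^ (-((2 + ν) / (1 + ν))) := by gcongr
        _ = _ := by ring
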